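/- Let $a,b>0$ and $0<\beta\le 1$. On a probability space, let $\{N(t)\}_{t\ge 0}$ be a Poisson process with rate $1$ and let $\{D_\beta(t)\}_{t\ge 0}$ be an independent $\beta$-stable subordinator, that is, a process with nondecreasing right-continuous paths and stationary independent increments, $D_\beta(0)=0$ and $\mathbb{E}[e^{-sD_\beta(t)}]=e^{-ts^\beta}$ for $s,t\ge 0$ (so $D_1(t)=t$). Let $E_\beta(t)=\inf\{r>0: D_\beta(r)>t\}$ be its right-continuous inverse, let $\Lambda(t)=(t/b)^a$ be the Weibull rate function, and define the fractional non-homogeneous Poisson process (FNPP) $$W^{(2)}_\beta(t)=N(\Lambda(E_\beta(t))),\qquad t\ge 0.$$ If $0<a\beta<1$, then $\{W^{(2)}_\beta(t)\}_{t\ge0}$ has the long-range dependence (LRD) property: $W^{(2)}_\beta(t)$ is square integrable for every $t\ge 0$, and there is an exponent $d\in(0,1)$ such that for every fixed $s>0$ there is a constant $c(s)>0$ with $$\lim_{t\to\infty}\frac{\operatorname{Corr}\big[W^{(2)}_\beta(s),W^{(2)}_\beta(t)\big]}{t^{-d}}=c(s),$$ where $\operatorname{Corr}[X,Y]=\operatorname{Cov}[X,Y]/\sqrt{\operatorname{Var}[X]\operatorname{Var}[Y]}$.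 -/

import Mathlib

open MeasureTheory ProbabilityTheory Filter Topology Set
open scoped NNReal

/-- `N` is a (homogeneous) Poisson process with rate `lam` on the probability space `(Ω, P)`:
a counting process started at `0`, with independent increments, with
`N t - N s` Poisson distributed with parameter `lam * (t - s)` for `s ≤ t`, and whose paths are
almost surely nondecreasing and right-continuous. -/
structure IsPoissonProcess {Ω : Type*} [MeasurableSpace Ω] (N : ℝ≥0 → Ω → ℕ) (lam : ℝ≥0)
    (P : Measure Ω) : Prop where
  measurable : ∀ t, Measurable (N t)
  zero : ∀ᵐ ω ∂P, N 0 ω = 0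
  indep_increments : HasIndepIncrements N P
  law_increment : ∀ s t : ℝ≥0, s ≤ t →
    P.map (fun ω => N t ω - N s ω) = poissonMeasure (lam * (t - s))
  monotone_paths : ∀ᵐ ω ∂P, Monotone fun t => N t ω
  right_continuous_paths : ∀ᵐ ω ∂P, ∀ t, ContinuousWithinAt (fun u => N u ω) (Ici t) t

/-- `D` is a `β`-stable subordinator on `(Ω, P)`: a process started at `0` with independent and
stationary increments, almost surely nondecreasing right-continuous paths, and Laplace transform
`𝔼[exp (-s D(t))] = exp (-t s ^ β)`. -/
structure IsStableSubordinator {Ω : Type*} [MeasurableSpace Ω] (D : ℝ≥0 → Ω → ℝ) (β : ℝ)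
    (P : Measure Ω) : Prop where
  measurable : ∀ t, Measurable (D t)
  zero : ∀ᵐ ω ∂P, D 0 ω = 0
  indep_increments : HasIndepIncrements D P
  stationary_increments : ∀ t h : ℝ≥0,
    P.map (fun ω => D (t + h) ω - D t ω) = P.map (D h)
  monotone_paths : ∀ᵐ ω ∂P, Monotone fun t => D t ω
  right_continuous_paths : ∀ᵐ ω ∂P, ∀ t, ContinuousWithinAt (fun u => D u ω) (Ici t) t
  laplace : ∀ t s : ℝ≥0,
    ∫ ω, Real.exp (-(s * D t ω)) ∂P = Real.exp (-(t * (s : ℝ) ^ β))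

/-- The right-continuous inverse `E(t) = inf {r > 0 : D(r) > t}` of a process `D`; when `D` is a
`β`-stable subordinator this is the inverse `β`-stable subordinator. -/
noncomputable def inverseProcess {Ω : Type*} (D : ℝ≥0 → Ω → ℝ) (t : ℝ≥0) (ω : Ω) : ℝ≥0 :=
  sInf {r : ℝ≥0 | 0 < r ∧ (t : ℝ) < D r ω}

/-- The Weibull rate function `Λ(t) = (t / b) ^ a`. -/
noncomputable def weibullRate (a : ℝ) (b t : ℝ≥0) : ℝ≥0 := (t / b) ^ a

/-- The fractional non-homogeneous Poisson process `W(t) = N(Λ(E(t)))` built from a counting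
process `N`, a rate function `Λ` and the inverse `E` of `D`. -/
noncomputable def fnpp {Ω : Type*} (N : ℝ≥0 → Ω → ℕ) (Λ : ℝ≥0 → ℝ≥0) (D : ℝ≥0 → Ω → ℝ)
    (t : ℝ≥0) (ω : Ω) : ℝ :=
  N (Λ (inverseProcess D t ω)) ω

/-- The correlation coefficient of two real random variables. -/
noncomputable def correlation {Ω : Type*} [MeasurableSpace Ω] (X Y : Ω → ℝ) (P : Measure Ω) : ℝ :=
  covariance X Y P / Real.sqrt (variance X P * variance Y P)

/-- The long-range dependence property: `X` is square integrable and there is an exponent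
`d ∈ (0, 1)` such that for each fixed `s > 0` the quotient `Corr[X(s), X(t)] / t ^ (-d)`
converges, as `t → ∞`, to some `c(s) > 0`. -/
def HasLongRangeDependence {Ω : Type*} [MeasurableSpace Ω] (X : ℝ≥0 → Ω → ℝ)
    (P : Measure Ω) : Prop :=
  (∀ t, MemLp (X t) 2 P) ∧
    ∃ d : ℝ, 0 < d ∧ d < 1 ∧ ∀ s : ℝ≥0, 0 < s → ∃ c : ℝ, 0 < c ∧
      Tendsto (fun t : ℝ≥0 => correlation (X s) (X t) P / (t : ℝ) ^ (-d)) atTop (𝓝 c)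

/-! Write `E` for the inverse subordinator, `W` for the FNPP and `κ = b⁻ᵃ`. Conditioning on `D`
turns the moments of `W` into those of `Eᵃ`: for `s ≤ t`, `Cov(W s, W t) = κ 𝔼[E(s)ᵃ] + κ²
Cov(E(s)ᵃ, E(t)ᵃ)` (`covariance_fnpp`).

Variance: comparing Laplace transforms shows that `E(t)` has the law of `t^β E(1)` (`map_inverse`),
so `Var W(t) = κ m t^(βa) + κ² V t^(2βa)` with `m`, `V` the mean and variance of `E(1)ᵃ`. If `β <
1`, then `E(1)` is not deterministic, `V > 0`, and the standard deviation grows like `t^(βa)`.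

Covariance: `E(t) > w` means that `D` is still at most `t` at some time after `w`. Independent
stationary increments then squeeze the joint tail `P(E(s) > u, E(t) > u + w)` between `P(E(s) > u)
P(E(t-s) > w)` and `P(E(s) > u) P(E(t) > w)`. Integrating these bounds over `u` and `w` (layer cake)
squeezes `𝔼[E(s)ᵃ E(t)ᵃ]` between averages of `(u + E(t-s))ᵃ` and `(u + E(t))ᵃ`, with `u` weighted
by `tailMeasure`. Since that measure has mass `𝔼[E(s)ᵃ]`, subtracting the product of means leaves
averaged increments `(u + yz)ᵃ - (yz)ᵃ` with `z = E(1)` and `y` equal to `(t-s)^β` or `t^β`. The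
lower bound carries an additional error of order `t^(aβ) - (t-s)^(aβ)`, which vanishes because `aβ <
1`. The averaged increments converge after division by `y^(max(a-1, 0))`
(`exists_tendsto_covariance_inverse`).

Hence `Cov(W s, W t)` is of exact order `t^(β max(a-1, 0))`. Its leading constant is positive thanks
to the Poisson term `κ 𝔼[E(s)ᵃ]` if `a ≤ 1`, and to the derivative term `∫ a u z^(a-1)` if `a > 1`.
The exponent is `d = βa - β max(a-1, 0) = β min(a, 1)`, which is in `(0,1)`.

If `β = 1`, then `E(t) = t` and `V = 0`. The covariance is `κ sᵃ`, the variance `κ tᵃ`, and `d =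
a/2`. -/

open scoped ENNReal

/-! ### Moments of the Poisson process -/

/-- The Stein–Chen identity for the Poisson distribution. -/
lemma lintegral_natCast_mul_poissonMeasure (r : ℝ≥0) (g : ℕ → ℝ≥0∞) :
    ∫⁻ n, (n : ℝ≥0∞) * g n ∂(poissonMeasure r) = r * ∫⁻ n, g (n + 1) ∂(poissonMeasure r) := by
  simp only [poissonMeasure, lintegral_sum_measure, lintegral_smul_measure, lintegral_dirac,
    smul_eq_mul]
  rw [tsum_eq_zero_add' ENNReal.summable, ← ENNReal.tsum_mul_left]
  simp only [Nat.cast_zero, zero_mul, mul_zero, zero_add]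
  refine tsum_congr fun n => ?_
  rw [← mul_assoc, ← mul_assoc]
  congr 1
  rw [← ENNReal.ofReal_natCast, ← ENNReal.ofReal_coe_nnreal (p := r),
    ← ENNReal.ofReal_mul (by positivity), ← ENNReal.ofReal_mul (by positivity)]
  congr 1
  rw [Nat.factorial_succ]
  push_cast
  field_simp
  ring

lemma lintegral_natCast_poissonMeasure (r : ℝ≥0) :
    ∫⁻ n, (n : ℝ≥0∞) ∂(poissonMeasure r) = r := by
  simpa using lintegral_natCast_mul_poissonMeasure r fun _ => 1

lemma lintegral_natCast_sq_poissonMeasure (r : ℝ≥0) :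
    ∫⁻ n, (n : ℝ≥0∞) * n ∂(poissonMeasure r) = r + r * r := by
  rw [lintegral_natCast_mul_poissonMeasure]
  simp only [Nat.cast_add, Nat.cast_one]
  rw [lintegral_add_right _ measurable_const, lintegral_natCast_poissonMeasure]
  simp [mul_add, add_comm]

namespace IsPoissonProcess

variable {Ω : Type*} [MeasurableSpace Ω] {P : Measure Ω} {N : ℝ≥0 → Ω → ℕ}

lemma lintegral_comp_sub (hN : IsPoissonProcess N 1 P) {s t : ℝ≥0} (hst : s ≤ t)
    (f : ℕ → ℝ≥0∞) :
    ∫⁻ ω, f (N t ω - N s ω) ∂P = ∫⁻ n, f n ∂(poissonMeasure (t - s)) := by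
  have hm : Measurable fun ω => N t ω - N s ω := (hN.measurable t).sub (hN.measurable s)
  rw [← one_mul (t - s), ← hN.law_increment s t hst, lintegral_map measurable_from_top hm]

lemma lintegral_comp (hN : IsPoissonProcess N 1 P) (t : ℝ≥0) (f : ℕ → ℝ≥0∞) :
    ∫⁻ ω, f (N t ω) ∂P = ∫⁻ n, f n ∂(poissonMeasure t) := by
  have h := hN.lintegral_comp_sub (zero_le (a := t)) f
  rw [tsub_zero] at h
  rw [← h]
  refine lintegral_congr_ae ?_
  filter_upwards [hN.zero] with ω h
  simp [h]

lemma lintegral_natCast (hN : IsPoissonProcess N 1 P) (t : ℝ≥0) :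
    ∫⁻ ω, (N t ω : ℝ≥0∞) ∂P = t := by
  rw [hN.lintegral_comp t fun n => (n : ℝ≥0∞), lintegral_natCast_poissonMeasure]

/-- For `s ≤ t`, `N t` is `N s` plus an independent Poisson increment, which gives `(s + s²) + s (t
- s)`. -/
lemma lintegral_natCast_mul_natCast (hN : IsPoissonProcess N 1 P) {s t : ℝ≥0} (hst : s ≤ t) :
    ∫⁻ ω, (N s ω : ℝ≥0∞) * N t ω ∂P = s + s * t := by
  have hmeas : ∀ t, Measurable fun ω => (N t ω : ℝ≥0∞) := fun t =>
    measurable_from_top.comp (hN.measurable t)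
  have hmeas' : Measurable fun ω => ((N t ω - N s ω : ℕ) : ℝ≥0∞) :=
    measurable_from_top.comp ((hN.measurable t).sub (hN.measurable s))
  have hsplit : ∫⁻ ω, (N s ω : ℝ≥0∞) * N t ω ∂P
      = ∫⁻ ω, ((N s ω : ℝ≥0∞) * N s ω + (N s ω : ℝ≥0∞) * ((N t ω - N s ω : ℕ) : ℝ≥0∞)) ∂P := by
    refine lintegral_congr_ae ?_
    filter_upwards [hN.monotone_paths] with ω hω
    -- Subtraction in `ℕ` is truncated; monotone paths make it the true increment.
    rw [← mul_add, ← Nat.cast_add, Nat.add_sub_cancel' (hω hst)]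
  have hind : IndepFun (N s) (N t - N s) P := by
    refine (hN.indep_increments.indepFun_sub_sub zero_le hst).congr ?_ .rfl
    filter_upwards [hN.zero] with ω hω
    simp [hω]
  have hprod : ∫⁻ ω, (N s ω : ℝ≥0∞) * ((N t ω - N s ω : ℕ) : ℝ≥0∞) ∂P
      = (∫⁻ ω, (N s ω : ℝ≥0∞) ∂P) * ∫⁻ ω, ((N t ω - N s ω : ℕ) : ℝ≥0∞) ∂P :=
    lintegral_mul_eq_lintegral_mul_lintegral_of_indepFun (hmeas s) hmeas'
      (hind.comp (φ := fun n : ℕ => (n : ℝ≥0∞)) (ψ := fun n : ℕ => (n : ℝ≥0∞))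
        measurable_from_top measurable_from_top)
  have hmul : Measurable fun ω => (N s ω : ℝ≥0∞) * N s ω := (hmeas s).mul (hmeas s)
  rw [hsplit, lintegral_add_left hmul, hprod, hN.lintegral_natCast,
    hN.lintegral_comp_sub hst fun n => (n : ℝ≥0∞), lintegral_natCast_poissonMeasure,
    hN.lintegral_comp s fun n => (n : ℝ≥0∞) * n, lintegral_natCast_sq_poissonMeasure, add_assoc,
    ← mul_add, ← ENNReal.coe_add, add_tsub_cancel_of_le hst]

end IsPoissonProcess

/-! ### Evaluating a counting process at an independent random time -/

/-- Evaluation of a path at a time, as the infimum of its values at grid points to the right of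
that time. It agrees with evaluation on nondecreasing right-continuous paths and it is measurable
for the product `σ`-algebra. -/
noncomputable def rightEval (p : (ℝ≥0 → ℕ) × ℝ≥0) : ℕ :=
  ⨅ k : ℕ, p.1 ((⌊(k + 1 : ℝ≥0) * p.2⌋₊ + 1) / (k + 1))

lemma measurable_rightEval : Measurable rightEval := by
  refine Measurable.iInf fun k => ?_
  have h1 : Measurable fun q : (ℝ≥0 → ℕ) × ℕ => q.1 ((q.2 + 1) / (k + 1)) :=
    measurable_from_prod_countable_left fun m =>
      measurable_pi_apply (((m : ℝ≥0) + 1) / (k + 1))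
  have h2 : Measurable fun p : (ℝ≥0 → ℕ) × ℝ≥0 => (p.1, ⌊(k + 1 : ℝ≥0) * p.2⌋₊) :=
    measurable_fst.prodMk (Nat.measurable_floor.comp (measurable_snd.const_mul _))
  exact h1.comp h2

/-- The grid points lie to the right of `t`, within `1 / (k + 1)` of it. As `ℕ` is discrete,
right-continuity forces `f (u k) = f t` eventually, and monotonicity makes this the least value on
the grid. -/
lemma rightEval_eq {f : ℝ≥0 → ℕ} (hf : Monotone f) {t : ℝ≥0}
    (hc : ContinuousWithinAt f (Ici t) t) : rightEval (f, t) = f t := by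
  set u : ℕ → ℝ≥0 := fun k => (⌊(k + 1 : ℝ≥0) * t⌋₊ + 1) / (k + 1) with hu
  have hlt : ∀ k, t ≤ u k := fun k => by
    rw [hu, le_div_iff₀ (by positivity), mul_comm]
    exact (Nat.lt_floor_add_one _).le
  have hle : ∀ k, u k ≤ t + 1 / (k + 1) := fun k => by
    have hk : (0 : ℝ≥0) < k + 1 := by positivity
    rw [hu, div_le_iff₀ hk, add_mul t, div_mul_cancel₀ _ hk.ne', mul_comm t]
    gcongr
    exact Nat.floor_le zero_le
  have hlim : Tendsto u atTop (𝓝[≥] t) := by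
    refine tendsto_nhdsWithin_iff.2 ⟨?_, Eventually.of_forall hlt⟩
    refine tendsto_of_tendsto_of_tendsto_of_le_of_le tendsto_const_nhds ?_ hlt hle
    have : Tendsto (fun k : ℕ => (1 : ℝ≥0) / (k + 1)) atTop (𝓝 0) :=
      tendsto_one_div_add_atTop_nhds_zero_nat
    simpa using this.const_add t
  have hev : ∀ᶠ k in atTop, f (u k) = f t := by
    have := hc.tendsto.comp hlim
    rw [nhds_discrete, tendsto_pure] at this
    exact this
  obtain ⟨k, hk⟩ := hev.exists
  refine le_antisymm ((ciInf_le (OrderBot.bddBelow _) k).trans hk.le) ?_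
  exact le_ciInf fun k => hf (hlt k)

namespace IsPoissonProcess

variable {Ω : Type*} [MeasurableSpace Ω] {P : Measure Ω} {N : ℝ≥0 → Ω → ℕ}

lemma ae_rightEval_eq (hN : IsPoissonProcess N 1 P) :
    ∀ᵐ ω ∂P, ∀ t, rightEval (fun t => N t ω, t) = N t ω := by
  filter_upwards [hN.monotone_paths, hN.right_continuous_paths] with ω h1 h2 t
  exact rightEval_eq h1 (h2 t)

lemma measurable_path (hN : IsPoissonProcess N 1 P) : Measurable fun ω t => N t ω :=
  measurable_pi_iff.2 hN.measurable

lemma aemeasurable_comp (hN : IsPoissonProcess N 1 P) {Y : Ω → ℝ≥0} (hY : AEMeasurable Y P) :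
    AEMeasurable (fun ω => N (Y ω) ω) P := by
  refine (measurable_rightEval.comp_aemeasurable (hN.measurable_path.aemeasurable.prodMk hY)).congr ?_
  filter_upwards [hN.ae_rightEval_eq] with ω h using h _

/-- Conditioning on an independent pair of random times. -/
lemma lintegral_comp_indepFun [IsProbabilityMeasure P] (hN : IsPoissonProcess N 1 P)
    {X Y : Ω → ℝ≥0} (hX : Measurable X) (hY : Measurable Y)
    (hind : IndepFun (fun ω t => N t ω) (fun ω => (X ω, Y ω)) P) (g : ℕ → ℕ → ℝ≥0∞) :
    ∫⁻ ω, g (N (X ω) ω) (N (Y ω) ω) ∂P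
      = ∫⁻ ω, ∫⁻ ω', g (N (X ω) ω') (N (Y ω) ω') ∂P ∂P := by
  -- `rightEval` makes the integrand jointly measurable in the path and the times, so that the
  -- product law and Tonelli apply.
  set G : (ℝ≥0 → ℕ) × (ℝ≥0 × ℝ≥0) → ℝ≥0∞ := fun p =>
    g (rightEval (p.1, p.2.1)) (rightEval (p.1, p.2.2)) with hG
  have hGm : Measurable G := by
    have h : Measurable fun q : ℕ × ℕ => g q.1 q.2 := Measurable.of_discrete
    exact h.comp ((measurable_rightEval.comp (measurable_fst.prodMk measurable_snd.fst)).prodMk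
      (measurable_rightEval.comp (measurable_fst.prodMk measurable_snd.snd)))
  have hXY := hX.prodMk hY
  have hlaw := (indepFun_iff_map_prod_eq_prod_map_map hN.measurable_path.aemeasurable
    hXY.aemeasurable).1 hind
  have : IsProbabilityMeasure (P.map fun ω t => N t ω) :=
    Measure.isProbabilityMeasure_map hN.measurable_path.aemeasurable
  have : IsProbabilityMeasure (P.map fun ω => (X ω, Y ω)) :=
    Measure.isProbabilityMeasure_map hXY.aemeasurable
  calc ∫⁻ ω, g (N (X ω) ω) (N (Y ω) ω) ∂P
      = ∫⁻ ω, G (fun t => N t ω, (X ω, Y ω)) ∂P := by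
        refine lintegral_congr_ae ?_
        filter_upwards [hN.ae_rightEval_eq] with ω h
        simp [hG, h]
    _ = ∫⁻ q, ∫⁻ p, G (p, q) ∂(P.map fun ω t => N t ω) ∂(P.map fun ω => (X ω, Y ω)) := by
        rw [← lintegral_map hGm (hN.measurable_path.prodMk hXY), hlaw,
          lintegral_prod_symm' _ hGm]
    _ = ∫⁻ ω, ∫⁻ p, G (p, (X ω, Y ω)) ∂(P.map fun ω t => N t ω) ∂P := by
        rw [lintegral_map _ hXY]
        exact hGm.lintegral_prod_left'
    _ = _ := by
        refine lintegral_congr fun ω => ?_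
        have hGω : Measurable fun p => G (p, (X ω, Y ω)) := hGm.comp measurable_prodMk_right
        rw [lintegral_map hGω hN.measurable_path]
        refine lintegral_congr_ae ?_
        filter_upwards [hN.ae_rightEval_eq] with ω' h
        simp [hG, h]

lemma lintegral_natCast_comp [IsProbabilityMeasure P] (hN : IsPoissonProcess N 1 P)
    {X : Ω → ℝ≥0} (hX : Measurable X)
    (hind : IndepFun (fun ω t => N t ω) (fun ω => (X ω, X ω)) P) :
    ∫⁻ ω, (N (X ω) ω : ℝ≥0∞) ∂P = ∫⁻ ω, (X ω : ℝ≥0∞) ∂P := by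
  rw [hN.lintegral_comp_indepFun hX hX hind fun n _ => (n : ℝ≥0∞)]
  simp only [hN.lintegral_natCast]

lemma lintegral_natCast_comp_mul [IsProbabilityMeasure P] (hN : IsPoissonProcess N 1 P)
    {X Y : Ω → ℝ≥0} (hX : Measurable X) (hY : Measurable Y)
    (hind : IndepFun (fun ω t => N t ω) (fun ω => (X ω, Y ω)) P) (hXY : ∀ᵐ ω ∂P, X ω ≤ Y ω) :
    ∫⁻ ω, (N (X ω) ω : ℝ≥0∞) * N (Y ω) ω ∂P = ∫⁻ ω, (X ω : ℝ≥0∞) + X ω * Y ω ∂P := by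
  rw [hN.lintegral_comp_indepFun hX hY hind fun n m => (n : ℝ≥0∞) * m]
  refine lintegral_congr_ae ?_
  filter_upwards [hXY] with ω h
  rw [hN.lintegral_natCast_mul_natCast h]

end IsPoissonProcess

/-! ### Uniqueness of the Laplace transform -/

section Laplace

variable {Ω Ω' : Type*} [MeasurableSpace Ω] [MeasurableSpace Ω']

/-- The complex moment generating function of a bounded random variable is the exponential
generating function of its moments. -/
lemma hasSum_complexMGF_of_abs_le_one {P : Measure Ω} [IsProbabilityMeasure P] {X : Ω → ℝ}
    (hX : Measurable X) (hb : ∀ᵐ ω ∂P, |X ω| ≤ 1) (z : ℂ) :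
    HasSum (fun n : ℕ => z ^ n / n.factorial * ((∫ ω, X ω ^ n ∂P : ℝ) : ℂ))
      (complexMGF X P z) := by
  have h := hasSum_integral_of_dominated_convergence (μ := P)
    (F := fun (n : ℕ) ω => (z * X ω) ^ n / (n.factorial : ℂ))
    (f := fun ω => Complex.exp (z * X ω)) (fun n _ => ‖z‖ ^ n / n.factorial)
    (fun n => by
      have : Measurable fun ω => (z * X ω) ^ n / (n.factorial : ℂ) := by fun_prop
      exact this.aestronglyMeasurable)
    (fun n => by
      filter_upwards [hb] with ω hω
      rw [norm_div, norm_pow, norm_mul, Complex.norm_real, Complex.norm_natCast, Real.norm_eq_abs]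
      gcongr
      exact mul_le_of_le_one_right (norm_nonneg _) hω)
    (Eventually.of_forall fun _ => Real.summable_pow_div_factorial _)
    (integrable_const _)
    (Eventually.of_forall fun ω => by
      rw [Complex.exp_eq_exp_ℂ]
      exact NormedSpace.expSeries_div_hasSum_exp _)
  refine (congrArg (HasSum · _) (funext fun n => ?_)).mpr h
  rw [← integral_complex_ofReal, ← integral_const_mul]
  refine integral_congr_ae (Eventually.of_forall fun ω => ?_)
  simp only [mul_pow, Complex.ofReal_pow]
  ring

/-- Nonnegative random variables are determined in law by the values of their Laplace transforms
at the natural numbers. -/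
lemma map_eq_of_integral_exp_neg_natCast_mul {P : Measure Ω} {P' : Measure Ω'}
    [IsProbabilityMeasure P] [IsProbabilityMeasure P'] {X : Ω → ℝ} {Y : Ω' → ℝ}
    (hX : Measurable X) (hY : Measurable Y) (hX0 : ∀ᵐ ω ∂P, 0 ≤ X ω) (hY0 : ∀ᵐ ω ∂P', 0 ≤ Y ω)
    (h : ∀ n : ℕ, ∫ ω, Real.exp (-(n * X ω)) ∂P = ∫ ω, Real.exp (-(n * Y ω)) ∂P') :
    P.map X = P'.map Y := by
  have hXm : Measurable fun ω => Real.exp (-X ω) := by fun_prop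
  have hYm : Measurable fun ω => Real.exp (-Y ω) := by fun_prop
  have hpow : ∀ (n : ℕ) (x : ℝ), Real.exp (-x) ^ n = Real.exp (-(n * x)) := fun n x => by
    rw [← Real.exp_nat_mul, mul_neg]
  -- `exp (-X)` takes values in `[0, 1]` and its moments are the given Laplace values. A bounded
  -- variable is determined by its moments; the logarithm then recovers `X`.
  have key : P.map (fun ω => Real.exp (-X ω)) = P'.map (fun ω => Real.exp (-Y ω)) := by
    refine Measure.ext_of_complexMGF_eq hXm.aemeasurable hYm.aemeasurable (funext fun z => ?_)
    have hsX := hasSum_complexMGF_of_abs_le_one hXm (P := P) (by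
      filter_upwards [hX0] with ω hω
      simpa [Real.abs_exp] using hω) z
    have hsY := hasSum_complexMGF_of_abs_le_one hYm (P := P') (by
      filter_upwards [hY0] with ω hω
      simpa [Real.abs_exp] using hω) z
    simp only [hpow, h] at hsX hsY
    exact hsX.unique hsY
  have hlog := congrArg (Measure.map fun x => -Real.log x) key
  rw [Measure.map_map (by fun_prop) hXm, Measure.map_map (by fun_prop) hYm] at hlog
  simpa [Function.comp_def] using hlog

end Laplace

/-! ### A measurable version of the inverse of a path -/

/-- The right-continuous inverse of a path, computed on rational times only. -/
noncomputable def pathInverse (t : ℝ≥0) (f : ℝ≥0 → ℝ) : ℝ≥0 :=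
  (⨅ q : ℚ, if 0 < Real.toNNReal q ∧ (t : ℝ) < f (Real.toNNReal q)
    then (Real.toNNReal q : ℝ≥0∞) else ⊤).toNNReal

/-- A measurable version of the inverse process. -/
noncomputable def measurableInverse {Ω : Type*} (D : ℝ≥0 → Ω → ℝ) (t : ℝ≥0) (ω : Ω) : ℝ≥0 :=
  pathInverse t fun r => D r ω

lemma measurable_pathInverse (t : ℝ≥0) : Measurable (pathInverse t) := by
  refine Measurable.ennreal_toNNReal (Measurable.iInf fun q => ?_)
  refine Measurable.ite ?_ measurable_const measurable_const
  exact (MeasurableSet.const _).inter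
    (measurableSet_lt measurable_const (measurable_pi_apply _))

section Path

variable {f : ℝ≥0 → ℝ} {t : ℝ≥0}

/-- A monotone path above `t` at time `r` is above `t` at every rational after `r`, so restricting
to rationals does not change the infimum. -/
lemma pathInverse_eq (hf : Monotone f) (hne : ∃ r, 0 < r ∧ (t : ℝ) < f r) :
    pathInverse t f = sInf {r : ℝ≥0 | 0 < r ∧ (t : ℝ) < f r} := by
  set S := {r : ℝ≥0 | 0 < r ∧ (t : ℝ) < f r} with hS
  have hbdd : BddBelow S := OrderBot.bddBelow S
  suffices h : (⨅ q : ℚ, if 0 < Real.toNNReal q ∧ (t : ℝ) < f (Real.toNNReal q)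
      then (Real.toNNReal q : ℝ≥0∞) else ⊤) = ((sInf S : ℝ≥0) : ℝ≥0∞) by
    rw [pathInverse, h, ENNReal.toNNReal_coe]
  refine le_antisymm ?_ (le_iInf fun q => ?_)
  · refine le_of_forall_gt_imp_ge_of_dense fun c hc => ?_
    rcases eq_or_ne c ⊤ with rfl | hc'
    · exact le_top
    lift c to ℝ≥0 using hc'
    rw [ENNReal.coe_lt_coe] at hc
    obtain ⟨r, hr, hrc⟩ := (csInf_lt_iff hbdd hne).1 hc
    obtain ⟨q, -, hrq, hqc⟩ := (NNReal.lt_iff_exists_rat_btwn r c).1 hrc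
    refine (iInf_le _ q).trans ?_
    rw [if_pos ⟨hr.1.trans hrq, hr.2.trans_le (hf hrq.le)⟩]
    exact_mod_cast hqc.le
  · split_ifs with h
    · exact_mod_cast csInf_le hbdd h
    · exact le_top

/-- This translates tails of the inverse into events about the path at a single time. The strict gap
`w < r` matters: `f w ≤ t` would not suffice, as `f` may exceed `t` immediately after `w`. -/
lemma lt_pathInverse_iff (hf : Monotone f) (hne : ∃ r, 0 < r ∧ (t : ℝ) < f r) {w : ℝ≥0} :
    w < pathInverse t f ↔ ∃ r, w < r ∧ f r ≤ t := by
  rw [pathInverse_eq hf hne]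
  constructor
  · intro h
    obtain ⟨r, hwr, hr⟩ := exists_between h
    refine ⟨r, hwr, not_lt.1 fun hlt => ?_⟩
    exact notMem_of_lt_csInf hr (OrderBot.bddBelow _) ⟨(zero_le).trans_lt hwr, hlt⟩
  · rintro ⟨r, hwr, hr⟩
    refine hwr.trans_le (le_csInf hne fun x hx => ?_)
    by_contra! hlt
    exact (hx.2.trans_le (hf hlt.le)).not_ge hr

lemma pathInverse_mono (hf : Monotone f) (hne : ∀ t : ℝ≥0, ∃ r, 0 < r ∧ (t : ℝ) < f r)
    {s t : ℝ≥0} (hst : s ≤ t) : pathInverse s f ≤ pathInverse t f := by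
  refine le_of_forall_lt fun w hw => ?_
  obtain ⟨r, hwr, hr⟩ := (lt_pathInverse_iff hf (hne s)).1 hw
  exact (lt_pathInverse_iff hf (hne t)).2 ⟨r, hwr, hr.trans (by exact_mod_cast hst)⟩

end Path

/-! ### Tails, self-similarity and moments of the inverse subordinator -/

namespace IsStableSubordinator

variable {Ω : Type*} [MeasurableSpace Ω] {P : Measure Ω} {D : ℝ≥0 → Ω → ℝ} {β : ℝ}

lemma measurable_path (hD : IsStableSubordinator D β P) : Measurable fun ω r => D r ω :=
  measurable_pi_iff.2 hD.measurable

lemma ae_nonneg (hD : IsStableSubordinator D β P) : ∀ᵐ ω ∂P, ∀ t, 0 ≤ D t ω := by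
  filter_upwards [hD.monotone_paths, hD.zero] with ω h1 h2 t
  exact h2.symm.le.trans (h1 (zero_le (a := t)))

lemma measure_increment_le (hD : IsStableSubordinator D β P) (r h x : ℝ≥0) :
    P {ω | D (r + h) ω - D r ω ≤ x} = P {ω | D h ω ≤ x} := by
  have hm : Measurable fun ω => D (r + h) ω - D r ω :=
    (hD.measurable _).sub (hD.measurable _)
  have := congrArg (fun μ => μ (Iic (x : ℝ))) (hD.stationary_increments r h)
  simp only [Measure.map_apply hm measurableSet_Iic,
    Measure.map_apply (hD.measurable h) measurableSet_Iic] at this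
  exact this

lemma measurable_inverse (hD : IsStableSubordinator D β P) (t : ℝ≥0) :
    Measurable (measurableInverse D t) :=
  (measurable_pathInverse t).comp hD.measurable_path

lemma measurable_coe_inverse (hD : IsStableSubordinator D β P) (t : ℝ≥0) :
    Measurable fun ω => (measurableInverse D t ω : ℝ) :=
  (hD.measurable_inverse t).coe_nnreal_real

lemma measure_and_increment_le (hD : IsStableSubordinator D β P) (r h s x : ℝ≥0) :
    P {ω | D r ω ≤ s ∧ D (r + h) ω - D r ω ≤ x} = P {ω | D r ω ≤ s} * P {ω | D h ω ≤ x} := by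
  have hind := hD.indep_increments.indepFun_eval_sub (zero_le (a := r))
    (le_add_of_nonneg_right (zero_le (a := h))) hD.zero
  rw [← hD.measure_increment_le r h x]
  exact hind.measure_inter_preimage_eq_mul (Iic (s : ℝ)) (Iic (x : ℝ)) measurableSet_Iic
    measurableSet_Iic

variable [IsProbabilityMeasure P]

lemma integrable_exp_neg (hD : IsStableSubordinator D β P) (t : ℝ≥0) {s : ℝ} (hs : 0 ≤ s) :
    Integrable (fun ω => Real.exp (-(s * D t ω))) P := by
  have hm := hD.measurable t
  refine Integrable.of_bound (by fun_prop) 1 ?_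
  filter_upwards [hD.ae_nonneg] with ω hω
  rw [Real.norm_eq_abs, Real.abs_exp, Real.exp_le_one_iff, neg_nonpos]
  exact mul_nonneg hs (hω t)

/-- Chernoff's bound at Laplace parameter `1`, where `1 ^ β = 1` removes `β`. It shows both that the
paths are unbounded and that the inverse has exponential tails. -/
lemma measure_le_le_exp (hD : IsStableSubordinator D β P) (r t : ℝ≥0) :
    P {ω | D r ω ≤ t} ≤ ENNReal.ofReal (Real.exp (t - r)) := by
  have h := measure_le_le_exp_mul_mgf (X := D r) (μ := P) (t : ℝ) (t := -1) (by norm_num)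
    (by simpa using hD.integrable_exp_neg r zero_le_one)
  have hl := hD.laplace r 1
  simp only [NNReal.coe_one, one_mul, Real.one_rpow, mul_one] at hl
  simp only [mgf, neg_mul, one_mul, neg_neg, hl, ← Real.exp_add] at h
  rw [← ofReal_measureReal]
  exact ENNReal.ofReal_le_ofReal (by simpa [sub_eq_add_neg] using h)

lemma ae_exists_lt (hD : IsStableSubordinator D β P) :
    ∀ᵐ ω ∂P, ∀ t : ℝ≥0, ∃ r, 0 < r ∧ (t : ℝ) < D r ω := by
  have h : ∀ m : ℕ, ∀ᵐ ω ∂P, ∃ n : ℕ, (m : ℝ) < D (n + 1) ω := by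
    intro m
    have hz : P {ω | ∀ n : ℕ, D (n + 1) ω ≤ m} = 0 := by
      refine le_antisymm (ge_of_tendsto' (f := fun n : ℕ =>
        ENNReal.ofReal (Real.exp ((m : ℝ) - (n + 1)))) (x := atTop) ?_ fun n => ?_) zero_le
      · rw [← ENNReal.ofReal_zero]
        refine (ENNReal.continuous_ofReal.tendsto 0).comp (Real.tendsto_exp_atBot.comp ?_)
        refine tendsto_atBot_add_const_left _ _ (tendsto_neg_atBot_iff.2 ?_)
        exact tendsto_atTop_add_const_right _ _ tendsto_natCast_atTop_atTop
      · refine (measure_mono fun ω hω => ?_).trans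
          ((hD.measure_le_le_exp (n + 1) m).trans_eq (by simp))
        simpa using hω n
    refine (ae_iff.2 ?_)
    simpa only [not_exists, not_lt] using hz
  filter_upwards [ae_all_iff.2 h] with ω hω t
  obtain ⟨m, hm⟩ := exists_nat_ge t
  obtain ⟨n, hn⟩ := hω m
  exact ⟨n + 1, by positivity, lt_of_le_of_lt (by exact_mod_cast hm) hn⟩

lemma ae_inverse_eq (hD : IsStableSubordinator D β P) :
    ∀ᵐ ω ∂P, ∀ t, measurableInverse D t ω = inverseProcess D t ω := by
  filter_upwards [hD.monotone_paths, hD.ae_exists_lt] with ω h1 h2 t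
  exact pathInverse_eq h1 (h2 t)

lemma ae_lt_inverse_iff (hD : IsStableSubordinator D β P) :
    ∀ᵐ ω ∂P, ∀ t w, w < measurableInverse D t ω ↔ ∃ r, w < r ∧ D r ω ≤ t := by
  filter_upwards [hD.monotone_paths, hD.ae_exists_lt] with ω h1 h2 t w
  exact lt_pathInverse_iff h1 (h2 t)

lemma ae_inverse_mono (hD : IsStableSubordinator D β P) {s t : ℝ≥0} (hst : s ≤ t) :
    ∀ᵐ ω ∂P, measurableInverse D s ω ≤ measurableInverse D t ω := by
  filter_upwards [hD.monotone_paths, hD.ae_exists_lt] with ω h1 h2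
  exact pathInverse_mono h1 h2 hst

lemma measure_le_le_measure_lt_inverse (hD : IsStableSubordinator D β P) {r w : ℝ≥0}
    (hwr : w < r) (t : ℝ≥0) : P {ω | D r ω ≤ t} ≤ P {ω | w < measurableInverse D t ω} := by
  refine measure_mono_ae ?_
  filter_upwards [hD.ae_lt_inverse_iff] with ω h hr
  exact (h t w).2 ⟨r, hwr, hr⟩

lemma measure_lt_inverse_le (hD : IsStableSubordinator D β P) (w t : ℝ≥0) :
    P {ω | w < measurableInverse D t ω} ≤ P {ω | D w ω ≤ t} := by
  refine measure_mono_ae ?_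
  filter_upwards [hD.ae_lt_inverse_iff, hD.monotone_paths] with ω h hm hw
  obtain ⟨r, hwr, hr⟩ := (h t w).1 hw
  exact (hm hwr.le).trans hr

/-- Joint tails of the inverse subordinator, approximated from inside. -/
lemma measure_lt_inverse_and_lt_inverse_le (hD : IsStableSubordinator D β P) (u v s t : ℝ≥0)
    {c : ℝ≥0∞} (hc : ∀ ε : ℝ≥0, 0 < ε → P {ω | D (u + ε) ω ≤ s ∧ D (v + 2 * ε) ω ≤ t} ≤ c) :
    P {ω | u < measurableInverse D s ω ∧ v < measurableInverse D t ω} ≤ c := by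
  -- Monotonicity of the path is built into `A n` so that these sets increase everywhere, not just
  -- almost surely. The shift is doubled at the second time so that, for `v = u + w`, the gap `(v +
  -- 2ε) - (u + ε) = w + ε` still exceeds `w`.
  set A : ℕ → Set Ω := fun n => {ω | Monotone (fun r => D r ω) ∧
    D (u + 1 / (n + 1)) ω ≤ s ∧ D (v + 2 * (1 / (n + 1))) ω ≤ t} with hA
  have hmono : Monotone A := by
    intro n m hnm ω hω
    have hle : (1 : ℝ≥0) / (m + 1) ≤ 1 / (n + 1) := by gcongr
    exact ⟨hω.1, (hω.1 (by gcongr)).trans hω.2.1, (hω.1 (by gcongr)).trans hω.2.2⟩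
  calc P {ω | u < measurableInverse D s ω ∧ v < measurableInverse D t ω}
      ≤ P (⋃ n, A n) := by
        refine measure_mono_ae ?_
        filter_upwards [hD.ae_lt_inverse_iff, hD.monotone_paths] with ω h hm hw
        obtain ⟨r, hur, hr⟩ := (h s u).1 hw.1
        obtain ⟨r', hvr, hr'⟩ := (h t v).1 hw.2
        have hlim : Tendsto (fun n : ℕ => (1 : ℝ≥0) / (n + 1)) atTop (𝓝 0) :=
          tendsto_one_div_add_atTop_nhds_zero_nat
        have h1 : Tendsto (fun n : ℕ => u + (1 : ℝ≥0) / (n + 1)) atTop (𝓝 u) := by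
          simpa using hlim.const_add u
        have h2 : Tendsto (fun n : ℕ => v + 2 * ((1 : ℝ≥0) / (n + 1))) atTop (𝓝 v) := by
          simpa using (hlim.const_mul 2).const_add v
        obtain ⟨n, hn1, hn2⟩ := ((h1.eventually_lt_const hur).and
          (h2.eventually_lt_const hvr)).exists
        exact mem_iUnion.2 ⟨n, hm, (hm hn1.le).trans hr, (hm hn2.le).trans hr'⟩
    _ = ⨆ n, P (A n) := hmono.measure_iUnion
    _ ≤ c := iSup_le fun n => (measure_mono fun ω hω => hω.2).trans (hc _ (by positivity))

lemma measure_lt_inverse_eq (hD : IsStableSubordinator D β P) (w t : ℝ≥0) :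
    P {ω | w < measurableInverse D t ω} = ⨆ r, ⨆ _ : w < r, P {ω | D r ω ≤ t} := by
  refine le_antisymm ?_ (iSup₂_le fun r hr => hD.measure_le_le_measure_lt_inverse hr t)
  have h := hD.measure_lt_inverse_and_lt_inverse_le w w t t
    (c := ⨆ r, ⨆ _ : w < r, P {ω | D r ω ≤ t}) fun ε hε =>
      (measure_mono fun ω hω => hω.1).trans
        (le_iSup₂ (f := fun r (_ : w < r) => P {ω | D r ω ≤ t}) (w + ε)
          (lt_add_of_pos_right w hε))
  simpa using h



/-- If `D` is at most `t` at the later time, so is its increment, because `D ≥ 0`; that increment is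
independent of the earlier value. -/
lemma measure_lt_inverse_and_le_mul (hD : IsStableSubordinator D β P) (u w s t : ℝ≥0) :
    P {ω | u < measurableInverse D s ω ∧ u + w < measurableInverse D t ω}
      ≤ P {ω | u < measurableInverse D s ω} * P {ω | w < measurableInverse D t ω} := by
  refine hD.measure_lt_inverse_and_lt_inverse_le u (u + w) s t fun ε hε => ?_
  calc P {ω | D (u + ε) ω ≤ s ∧ D (u + w + 2 * ε) ω ≤ t}
      ≤ P {ω | D (u + ε) ω ≤ s ∧ D ((u + ε) + (w + ε)) ω - D (u + ε) ω ≤ t} := by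
        refine measure_mono_ae ?_
        filter_upwards [hD.ae_nonneg] with ω h0 hω
        refine ⟨hω.1, ?_⟩
        have := hω.2
        rw [show u + w + 2 * ε = (u + ε) + (w + ε) by ring] at this
        linarith [h0 (u + ε)]
    _ = P {ω | D (u + ε) ω ≤ s} * P {ω | D (w + ε) ω ≤ t} :=
        hD.measure_and_increment_le _ _ _ _
    _ ≤ _ := mul_le_mul' (hD.measure_le_le_measure_lt_inverse (lt_add_of_pos_right u hε) s)
        (hD.measure_le_le_measure_lt_inverse (lt_add_of_pos_right w hε) t)

/-- Conversely, a value at most `s` followed by an independent increment at most `t - s` gives a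
value at most `t`. -/
lemma mul_le_measure_lt_inverse_and (hD : IsStableSubordinator D β P) (u w s : ℝ≥0) {t : ℝ≥0}
    (hst : s ≤ t) :
    P {ω | u < measurableInverse D s ω} * P {ω | w < measurableInverse D (t - s) ω}
      ≤ P {ω | u < measurableInverse D s ω ∧ u + w < measurableInverse D t ω} := by
  rw [hD.measure_lt_inverse_eq u s, hD.measure_lt_inverse_eq w (t - s)]
  simp only [ENNReal.iSup_mul, ENNReal.mul_iSup]
  refine iSup₂_le fun r' hr' => iSup₂_le fun r hr => ?_
  rw [← hD.measure_and_increment_le]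
  refine measure_mono_ae ?_
  filter_upwards [hD.ae_lt_inverse_iff] with ω h hω
  refine ⟨(h s u).2 ⟨r, hr, hω.1⟩, (h t (u + w)).2 ⟨r + r', add_lt_add hr hr', ?_⟩⟩
  have := hω.2
  rw [NNReal.coe_sub hst] at this
  linarith [hω.1]

/-- Self-similarity of the stable subordinator. -/
lemma map_mul_rpow (hD : IsStableSubordinator D β P) (r c : ℝ≥0) :
    P.map (D (r * c ^ β)) = P.map fun ω => (c : ℝ) * D r ω := by
  have hm := hD.measurable r
  refine map_eq_of_integral_exp_neg_natCast_mul (hD.measurable _) (by fun_prop) ?_ ?_ fun n => ?_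
  · filter_upwards [hD.ae_nonneg] with ω h using h _
  · filter_upwards [hD.ae_nonneg] with ω h using mul_nonneg c.2 (h _)
  · have h1 := hD.laplace (r * c ^ β) n
    have h2 := hD.laplace r (n * c)
    simp only [NNReal.coe_natCast, NNReal.coe_mul, NNReal.coe_rpow] at h1 h2
    simp only [← mul_assoc]
    rw [h1, h2, Real.mul_rpow (by positivity) (by positivity)]
    ring_nf

/-- Self-similarity of the inverse stable subordinator. -/
lemma map_inverse (hD : IsStableSubordinator D β P) {t : ℝ≥0} (ht : 0 < t) :
    P.map (measurableInverse D t) = P.map fun ω => t ^ β * measurableInverse D 1 ω := by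
  have hm := hD.measurable_inverse
  have hpos : 0 < t ^ β := NNReal.rpow_pos ht
  have hscale : ∀ r, P {ω | D (r * t ^ β) ω ≤ t} = P {ω | D r ω ≤ (1 : ℝ≥0)} := fun r => by
    have hmr := hD.measurable r
    have := congrArg (fun μ => μ (Iic (t : ℝ))) (hD.map_mul_rpow r t)
    simp only [Measure.map_apply (hD.measurable _) measurableSet_Iic,
      Measure.map_apply (hmr.const_mul (t : ℝ)) measurableSet_Iic] at this
    refine this.trans (congrArg P ?_)
    ext ω
    have ht' : (0 : ℝ) < t := ht
    simp [mul_le_iff_le_one_right ht']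
  have htail : ∀ w, P {ω | w < measurableInverse D t ω}
      = P {ω | w < t ^ β * measurableInverse D 1 ω} := fun w => by
    have : {ω | w < t ^ β * measurableInverse D 1 ω} = {ω | w / t ^ β < measurableInverse D 1 ω} := by
      ext ω
      rw [mem_ofPred_eq, mem_ofPred_eq, div_lt_iff₀' hpos]
    rw [this, hD.measure_lt_inverse_eq, hD.measure_lt_inverse_eq]
    refine le_antisymm (iSup₂_le fun r hr => ?_) (iSup₂_le fun r hr => ?_)
    · refine le_iSup₂_of_le (r / t ^ β) (by gcongr) ?_
      rw [← hscale, div_mul_cancel₀ _ hpos.ne']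
    · refine le_iSup₂_of_le (r * t ^ β) ((div_lt_iff₀ hpos).1 hr) ?_
      rw [← hscale]
  have : IsProbabilityMeasure (P.map (measurableInverse D t)) :=
    Measure.isProbabilityMeasure_map (hm t).aemeasurable
  have hm1 : Measurable fun ω => t ^ β * measurableInverse D 1 ω := (hm 1).const_mul _
  have : IsProbabilityMeasure (P.map fun ω => t ^ β * measurableInverse D 1 ω) :=
    Measure.isProbabilityMeasure_map hm1.aemeasurable
  refine Measure.ext_of_Iic _ _ fun w => ?_
  rw [← compl_Ioi, prob_compl_eq_one_sub measurableSet_Ioi, prob_compl_eq_one_sub measurableSet_Ioi,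
    Measure.map_apply (hm t) measurableSet_Ioi, Measure.map_apply hm1 measurableSet_Ioi]
  exact congrArg _ (htail w)

/-- The inverse subordinator has moments of all orders. -/
lemma lintegral_inverse_rpow_lt_top (hD : IsStableSubordinator D β P) (t : ℝ≥0) {p : ℝ}
    (hp : 0 < p) : ∫⁻ ω, ENNReal.ofReal ((measurableInverse D t ω : ℝ) ^ p) ∂P < ⊤ := by
  rw [lintegral_rpow_eq_lintegral_meas_lt_mul P (Eventually.of_forall fun ω => NNReal.coe_nonneg _)
    (hD.measurable_coe_inverse t).aemeasurable hp]
  refine ENNReal.mul_lt_top ENNReal.ofReal_lt_top ?_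
  -- The tail bound `exp (t - x)` dominates the layer-cake integral by a Gamma integral.
  have hG := (Real.GammaIntegral_convergent hp).const_mul (Real.exp t)
  refine lt_of_le_of_lt (setLIntegral_mono_ae (g := fun x => ENNReal.ofReal
    (Real.exp t * (Real.exp (-x) * x ^ (p - 1)))) (by fun_prop) ?_)
    (hG.lintegral_lt_top)
  refine Eventually.of_forall fun x (hx : 0 < x) => ?_
  rw [← mul_assoc, ← Real.exp_add, ENNReal.ofReal_mul (Real.exp_nonneg _)]
  gcongr
  have hset : {ω | x < (measurableInverse D t ω : ℝ)}
      = {ω | x.toNNReal < measurableInverse D t ω} := by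
    ext ω
    simp [Real.toNNReal_lt_iff_lt_coe hx.le]
  rw [hset]
  refine (hD.measure_lt_inverse_le _ t).trans ((hD.measure_le_le_exp _ t).trans_eq ?_)
  rw [Real.coe_toNNReal x hx.le, sub_eq_add_neg]

end IsStableSubordinator

/-! ### Asymptotics of averaged increments of a power function -/

/-- Concavity: the derivative at the left endpoint bounds the slope (Bernoulli's inequality at `u /
x`). -/
lemma rpow_add_sub_rpow_le_of_le_one {a u x : ℝ} (ha : 0 ≤ a) (ha1 : a ≤ 1) (hu : 0 ≤ u)
    (hx : 0 < x) : (u + x) ^ a - x ^ a ≤ a * u * x ^ (a - 1) := by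
  have h := rpow_one_add_le_one_add_mul_self (s := u / x) (by
    have : 0 ≤ u / x := by positivity
    linarith) ha ha1
  have h1 : u + x = x * (1 + u / x) := by field_simp; ring
  rw [h1, Real.mul_rpow hx.le (by positivity), Real.rpow_sub_one hx.ne']
  have := mul_le_mul_of_nonneg_left h (Real.rpow_nonneg hx.le a)
  calc x ^ a * (1 + u / x) ^ a - x ^ a ≤ x ^ a * (1 + a * (u / x)) - x ^ a := by linarith
    _ = a * u * (x ^ a / x) := by ring

/-- Convexity: the derivative at the right endpoint bounds the slope, hence Bernoulli's inequality
at `-u / (u + x)`, expanding around `u + x`. -/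
lemma rpow_add_sub_rpow_le_of_one_le {a u x : ℝ} (ha1 : 1 ≤ a) (hu : 0 < u)
    (hx : 0 ≤ x) : (u + x) ^ a - x ^ a ≤ a * u * (u + x) ^ (a - 1) := by
  have hux : 0 < u + x := by linarith
  have h := one_add_mul_self_le_rpow_one_add (s := -u / (u + x)) (by
    rw [le_div_iff₀ hux]; linarith) ha1
  have h1 : x = (u + x) * (1 + -u / (u + x)) := by field_simp; ring
  have h2 : x ^ a = (u + x) ^ a * (1 + -u / (u + x)) ^ a := by
    conv_lhs => rw [h1]
    refine Real.mul_rpow hux.le ?_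
    have : 1 + -u / (u + x) = x / (u + x) := by field_simp; ring
    rw [this]; positivity
  have := mul_le_mul_of_nonneg_left h (Real.rpow_nonneg hux.le a)
  rw [h2, Real.rpow_sub_one hux.ne']
  calc (u + x) ^ a - (u + x) ^ a * (1 + -u / (u + x)) ^ a
      ≤ (u + x) ^ a - (u + x) ^ a * (1 + a * (-u / (u + x))) := by linarith
    _ = a * u * ((u + x) ^ a / (u + x)) := by ring

lemma add_rpow_le_two_rpow_mul {a u x : ℝ} (ha : 0 ≤ a) (hu : 0 ≤ u) (hx : 0 ≤ x) :
    (u + x) ^ a ≤ 2 ^ a * (u ^ a + x ^ a) := by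
  have h1 : (u + x) ^ a ≤ (2 * max u x) ^ a := by
    refine Real.rpow_le_rpow (by positivity) ?_ ha
    linarith [le_max_left u x, le_max_right u x]
  rw [Real.mul_rpow (by norm_num) (by positivity)] at h1
  refine h1.trans (mul_le_mul_of_nonneg_left ?_ (by positivity))
  rcases max_cases u x with h | h <;> rw [h.1]
  · linarith [Real.rpow_nonneg hx a]
  · linarith [Real.rpow_nonneg hu a]

/-- After factoring out `y ^ a`, this is the difference quotient of `x ↦ (z + x u) ^ a` at `0` with
step `y⁻¹`. The condition `1 ≤ a` gives differentiability even when `z = 0`. -/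
lemma tendsto_rpow_add_mul_sub_of_one_le {a : ℝ} (ha : 1 ≤ a) (u z : ℝ) (hu : 0 ≤ u) (hz : 0 ≤ z) :
    Tendsto (fun y : ℝ => y ^ (1 - a) * ((u + y * z) ^ a - (y * z) ^ a)) atTop
      (𝓝 (a * u * z ^ (a - 1))) := by
  have hd : HasDerivAt (fun x : ℝ => (z + x * u) ^ a) (1 * u * a * (z + 0 * u) ^ (a - 1)) 0 :=
    (((hasDerivAt_id (0 : ℝ)).mul_const u).const_add z).rpow_const (Or.inr ha)
  rw [hasDerivAt_iff_tendsto_slope_zero] at hd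
  have hinv : Tendsto (fun y : ℝ => y⁻¹) atTop (𝓝[≠] 0) :=
    tendsto_inv_atTop_nhdsGT_zero.mono_right (nhdsWithin_mono _ fun x hx => ne_of_gt hx)
  have h := hd.comp hinv
  have hlim : 1 * u * a * (z + 0 * u) ^ (a - 1) = a * u * z ^ (a - 1) := by
    rw [zero_mul, add_zero]; ring
  rw [hlim] at h
  refine h.congr' ?_
  filter_upwards [eventually_gt_atTop 0] with y hy
  simp only [Function.comp_apply, zero_add, zero_mul, add_zero, inv_inv, smul_eq_mul]
  have h1 : u + y * z = y * (z + y⁻¹ * u) := by field_simp; ring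
  have h2 : 0 ≤ z + y⁻¹ * u := by positivity
  rw [h1, Real.mul_rpow hy.le h2, Real.mul_rpow hy.le hz, Real.rpow_sub hy, Real.rpow_one]
  have : y ^ a ≠ 0 := (Real.rpow_pos_of_pos hy a).ne'
  field_simp

section PowerIncrement

variable {X : Type*} [MeasurableSpace X] {η : Measure X} {u z : X → ℝ} {a : ℝ}

lemma exists_tendsto_integral_rpow_increment_of_lt_one (ha : 0 < a) (ha1 : a < 1)
    (hu : Measurable u) (hz : Measurable z) (hu0 : ∀ᵐ x ∂η, 0 < u x) (hz0 : ∀ᵐ x ∂η, 0 ≤ z x)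
    (hui : Integrable (fun x => u x ^ a) η) :
    ∃ L, 0 ≤ L ∧ Tendsto (fun y : ℝ => ∫ x, ((u x + y * z x) ^ a - (y * z x) ^ a) ∂η) atTop
      (𝓝 L) := by
  -- For `a < 1` the increment tends to `0` where `z > 0` and stays equal to `u ^ a` where `z = 0`.
  -- Subadditivity of the power supplies the dominating function `u ^ a`.
  refine ⟨∫ x, (if z x = 0 then u x ^ a else 0) ∂η, ?_, ?_⟩
  · refine integral_nonneg_of_ae ?_
    filter_upwards [hu0] with x hx
    show 0 ≤ ite _ _ _
    split_ifs <;> positivity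
  refine tendsto_integral_filter_of_dominated_convergence (fun x => u x ^ a) ?_ ?_ hui ?_
  · refine Eventually.of_forall fun y => ?_
    have : Measurable fun x => (u x + y * z x) ^ a - (y * z x) ^ a := by fun_prop
    exact this.aestronglyMeasurable
  · filter_upwards [eventually_ge_atTop 0] with y hy
    filter_upwards [hu0, hz0] with x hux hzx
    have hyz : 0 ≤ y * z x := mul_nonneg hy hzx
    have h1 : (y * z x) ^ a ≤ (u x + y * z x) ^ a :=
      Real.rpow_le_rpow hyz (by linarith) ha.le
    rw [Real.norm_eq_abs, abs_of_nonneg (by linarith)]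
    linarith [Real.rpow_add_le_add_rpow hux.le hyz ha.le ha1.le]
  · filter_upwards [hu0, hz0] with x hux hzx
    rcases hzx.eq_or_lt with h | h
    · simp [← h, Real.zero_rpow ha.ne']
    · rw [if_neg h.ne']
      have hyz : Tendsto (fun y : ℝ => y * z x) atTop atTop := tendsto_id.atTop_mul_const h
      have hlim : Tendsto (fun y : ℝ => a * u x * (y * z x) ^ (a - 1)) atTop (𝓝 0) := by
        have := (tendsto_rpow_neg_atTop (y := 1 - a) (by linarith)).comp hyz
        simpa [Function.comp_def] using this.const_mul (a * u x)
      refine squeeze_zero' ?_ ?_ hlim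
      · filter_upwards [hyz.eventually_gt_atTop 0] with y hy
        have : (y * z x) ^ a ≤ (u x + y * z x) ^ a :=
          Real.rpow_le_rpow hy.le (by linarith) ha.le
        linarith
      · filter_upwards [hyz.eventually_gt_atTop 0] with y hy
        exact rpow_add_sub_rpow_le_of_le_one ha.le ha1.le hux.le hy

lemma tendsto_integral_rpow_increment_of_one_le (ha : 1 ≤ a)
    (hu : Measurable u) (hz : Measurable z) (hu0 : ∀ᵐ x ∂η, 0 < u x) (hz0 : ∀ᵐ x ∂η, 0 ≤ z x)
    (hui : Integrable (fun x => u x ^ a) η) (hzi : Integrable (fun x => z x ^ a) η) :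
    Tendsto (fun y : ℝ => y ^ (1 - a) * ∫ x, ((u x + y * z x) ^ a - (y * z x) ^ a) ∂η) atTop
      (𝓝 (∫ x, a * u x * z x ^ (a - 1) ∂η)) := by
  have ha0 : 0 < a := by linarith
  simp only [← integral_const_mul]
  refine tendsto_integral_filter_of_dominated_convergence
    (fun x => a * (2 ^ a * (u x ^ a + z x ^ a))) ?_ ?_
    (((hui.add hzi).const_mul _).const_mul _) ?_
  · refine Eventually.of_forall fun y => ?_
    have : Measurable fun x => y ^ (1 - a) * ((u x + y * z x) ^ a - (y * z x) ^ a) := by fun_prop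
    exact this.aestronglyMeasurable
  · filter_upwards [eventually_ge_atTop 1] with y hy
    filter_upwards [hu0, hz0] with x hux hzx
    have hy0 : 0 < y := by linarith
    have hyz : 0 ≤ y * z x := by positivity
    have huz : 0 < u x + z x := by linarith
    have h1 : (y * z x) ^ a ≤ (u x + y * z x) ^ a :=
      Real.rpow_le_rpow hyz (by linarith) ha0.le
    -- For `y ≥ 1` this makes the powers of `y` cancel, leaving a dominating function free of `y`.
    have hle : u x + y * z x ≤ y * (u x + z x) := by nlinarith
    rw [Real.norm_eq_abs, abs_of_nonneg
      (mul_nonneg (by positivity) (by linarith))]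
    calc y ^ (1 - a) * ((u x + y * z x) ^ a - (y * z x) ^ a)
        ≤ y ^ (1 - a) * (a * u x * (u x + y * z x) ^ (a - 1)) := by
          gcongr
          exact rpow_add_sub_rpow_le_of_one_le ha hux hyz
      _ ≤ y ^ (1 - a) * (a * u x * (y * (u x + z x)) ^ (a - 1)) := by
          gcongr
      _ = a * (u x * (u x + z x) ^ (a - 1)) := by
          rw [Real.mul_rpow hy0.le huz.le, show 1 - a = -(a - 1) by ring, Real.rpow_neg hy0.le]
          have : y ^ (a - 1) ≠ 0 := (Real.rpow_pos_of_pos hy0 _).ne'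
          field_simp
      _ ≤ a * ((u x + z x) * (u x + z x) ^ (a - 1)) := by
          gcongr
          linarith
      _ = a * (u x + z x) ^ a := by
          rw [Real.rpow_sub_one huz.ne']
          field_simp
      _ ≤ _ := by
          gcongr
          exact add_rpow_le_two_rpow_mul ha0.le hux.le hzx
  · filter_upwards [hu0, hz0] with x hux hzx
    exact tendsto_rpow_add_mul_sub_of_one_le ha _ _ hux.le hzx

end PowerIncrement

/-- Increments of a sublinear power over a window of fixed width vanish at infinity. -/
lemma tendsto_rpow_sub_rpow_sub {p : ℝ} (hp : 0 < p) (hp1 : p < 1) {s : ℝ} (hs : 0 ≤ s) :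
    Tendsto (fun t : ℝ => t ^ p - (t - s) ^ p) atTop (𝓝 0) := by
  have hsub : Tendsto (fun t : ℝ => t - s) atTop atTop := tendsto_atTop_add_const_right _ _ tendsto_id
  have hlim : Tendsto (fun t : ℝ => p * s * (t - s) ^ (p - 1)) atTop (𝓝 0) := by
    have := (tendsto_rpow_neg_atTop (y := 1 - p) (by linarith)).comp hsub
    simpa [Function.comp_def] using this.const_mul (p * s)
  refine squeeze_zero' ?_ ?_ hlim
  · filter_upwards [hsub.eventually_gt_atTop 0] with t ht
    have : (t - s) ^ p ≤ t ^ p := Real.rpow_le_rpow ht.le (by linarith) hp.le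
    linarith
  · filter_upwards [hsub.eventually_gt_atTop 0] with t ht
    have := rpow_add_sub_rpow_le_of_le_one hp.le hp1.le hs ht
    rwa [add_sub_cancel] at this

/-! ### Layer-cake formulas -/

section LayerCake

variable {Ω Ω' : Type*} [MeasurableSpace Ω] [MeasurableSpace Ω'] {P : Measure Ω} {X : Ω → ℝ}
  {a : ℝ}

lemma lintegral_rpow_le_of_tail_le {μ : Measure Ω} {ν : Measure Ω'} {f : Ω → ℝ} {g : Ω' → ℝ}
    (hf : Measurable f) (hg : Measurable g) (hf0 : ∀ ω, 0 ≤ f ω) (hg0 : ∀ ω, 0 ≤ g ω)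
    (ha : 0 < a) (h : ∀ v, 0 < v → μ {ω | v < f ω} ≤ ν {ω | v < g ω}) :
    ∫⁻ ω, ENNReal.ofReal (f ω ^ a) ∂μ ≤ ∫⁻ ω, ENNReal.ofReal (g ω ^ a) ∂ν := by
  rw [lintegral_rpow_eq_lintegral_meas_lt_mul μ (Eventually.of_forall hf0) hf.aemeasurable ha,
    lintegral_rpow_eq_lintegral_meas_lt_mul ν (Eventually.of_forall hg0) hg.aemeasurable ha]
  refine mul_le_mul_right (setLIntegral_mono' measurableSet_Ioi fun v hv => ?_) _
  exact mul_le_mul_left (h v hv) _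

/-- The measure with density `a u ^ (a - 1) P(X > u)` on `(0, ∞)`. -/
noncomputable def tailMeasure (X : Ω → ℝ) (a : ℝ) (P : Measure Ω) : Measure ℝ :=
  (volume.restrict (Ioi 0)).withDensity fun u =>
    P {ω | u < X ω} * ENNReal.ofReal (a * u ^ (a - 1))

lemma measurable_measure_lt (X : Ω → ℝ) (P : Measure Ω) : Measurable fun u => P {ω | u < X ω} :=
  Antitone.measurable fun _ _ huv => measure_mono fun _ hω => lt_of_le_of_lt huv hω

lemma lintegral_tailMeasure {g : ℝ → ℝ≥0∞} (hg : Measurable g) :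
    ∫⁻ u, g u ∂(tailMeasure X a P)
      = ∫⁻ u in Ioi 0, P {ω | u < X ω} * ENNReal.ofReal (a * u ^ (a - 1)) * g u := by
  rw [tailMeasure, lintegral_withDensity_eq_lintegral_mul _ _ hg]
  · rfl
  · exact (measurable_measure_lt X P).mul (by fun_prop)

lemma ae_tailMeasure_pos : ∀ᵐ u ∂(tailMeasure X a P), 0 < u :=
  (withDensity_absolutelyContinuous _ _).ae_le (ae_restrict_mem measurableSet_Ioi)

/-- The layer-cake formula under the weighted measure `P.withDensity g`. -/
lemma lintegral_rpow_mul_eq (hX : Measurable X) (hX0 : ∀ ω, 0 ≤ X ω) (ha : 0 < a)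
    {g : Ω → ℝ≥0∞} (hg : Measurable g) :
    ∫⁻ ω, ENNReal.ofReal (X ω ^ a) * g ω ∂P
      = ∫⁻ u in Ioi 0, (∫⁻ ω in {ω | u < X ω}, g ω ∂P) * ENNReal.ofReal (a * u ^ (a - 1)) := by
  have hXa : Measurable fun ω => ENNReal.ofReal (X ω ^ a) := by fun_prop
  have h := lintegral_rpow_eq_lintegral_meas_lt_mul (P.withDensity g) (Eventually.of_forall hX0)
    hX.aemeasurable ha
  rw [lintegral_withDensity_eq_lintegral_mul _ hg hXa,
    ← lintegral_const_mul' _ _ ENNReal.ofReal_ne_top] at h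
  simp only [mul_comm _ (g _)]
  refine h.trans (setLIntegral_congr_fun measurableSet_Ioi fun u _ => ?_)
  rw [withDensity_apply _ (measurableSet_lt measurable_const hX), ENNReal.ofReal_mul ha.le]
  ring

lemma tailMeasure_univ (hX : Measurable X) (hX0 : ∀ ω, 0 ≤ X ω) (ha : 0 < a) :
    tailMeasure X a P univ = ∫⁻ ω, ENNReal.ofReal (X ω ^ a) ∂P := by
  have h := lintegral_rpow_mul_eq (P := P) hX hX0 ha (g := fun _ => 1) measurable_const
  simp only [mul_one, lintegral_const, Measure.restrict_apply MeasurableSet.univ, univ_inter,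
    one_mul] at h
  rw [h, ← lintegral_one, lintegral_tailMeasure measurable_const]
  simp

/-- Multiplying the density for exponent `a` by `u ^ a` gives `a u ^ (2a - 1)`, at most the density
for exponent `2a`. -/
lemma lintegral_rpow_tailMeasure_le (hX : Measurable X) (hX0 : ∀ ω, 0 ≤ X ω) (ha : 0 < a) :
    ∫⁻ u, ENNReal.ofReal (u ^ a) ∂(tailMeasure X a P)
      ≤ ∫⁻ ω, ENNReal.ofReal (X ω ^ (2 * a)) ∂P := by
  rw [← tailMeasure_univ hX hX0 (by linarith : 0 < 2 * a), ← lintegral_one,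
    lintegral_tailMeasure measurable_const, lintegral_tailMeasure (by fun_prop)]
  refine setLIntegral_mono' measurableSet_Ioi fun u (hu : 0 < u) => ?_
  rw [mul_one, mul_assoc, ← ENNReal.ofReal_mul (by positivity), mul_assoc, ← Real.rpow_add hu]
  rw [show a - 1 + a = 2 * a - 1 by ring]
  gcongr
  linarith

end LayerCake

/-! ### Joint moments of the inverse subordinator -/

namespace IsStableSubordinator

variable {Ω : Type*} [MeasurableSpace Ω] {P : Measure Ω} [IsProbabilityMeasure P]
  {D : ℝ≥0 → Ω → ℝ} {β a : ℝ}

/-- Phrasing the bound through the tail of `u + E(t)` covers every `v` at once: for `v < u` the last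
factor is `1`, and for `v = u + w` it is `P(E(t) > w)`. -/
lemma measure_lt_coe_inverse_and_le_mul (hD : IsStableSubordinator D β P) (s t : ℝ≥0) {u v : ℝ}
    (hu : 0 < u) (hv : 0 < v) :
    P {ω | v < (measurableInverse D t ω : ℝ) ∧ u < (measurableInverse D s ω : ℝ)}
      ≤ P {ω | u < (measurableInverse D s ω : ℝ)}
        * P {ω | v < u + (measurableInverse D t ω : ℝ)} := by
  lift u to ℝ≥0 using hu.le
  lift v to ℝ≥0 using hv.le
  simp only [← NNReal.coe_add, NNReal.coe_lt_coe]
  rcases lt_or_ge v u with h | h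
  · have : {ω | v < u + measurableInverse D t ω} = univ :=
      eq_univ_of_forall fun ω => h.trans_le le_self_add
    rw [this, measure_univ, mul_one]
    exact measure_mono fun ω hω => hω.2
  · obtain ⟨w, rfl⟩ := exists_add_of_le h
    simp only [add_lt_add_iff_left]
    refine (measure_mono ?_).trans (hD.measure_lt_inverse_and_le_mul u w s t)
    exact fun ω hω => ⟨hω.2, hω.1⟩

lemma mul_le_measure_lt_coe_inverse_and (hD : IsStableSubordinator D β P) {s t : ℝ≥0}
    (hst : s ≤ t) {u v : ℝ} (hu : 0 < u) (hv : 0 < v) :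
    P {ω | u < (measurableInverse D s ω : ℝ)}
        * P {ω | v < u + (measurableInverse D (t - s) ω : ℝ)}
      ≤ P {ω | v < (measurableInverse D t ω : ℝ) ∧ u < (measurableInverse D s ω : ℝ)} := by
  lift u to ℝ≥0 using hu.le
  lift v to ℝ≥0 using hv.le
  simp only [← NNReal.coe_add, NNReal.coe_lt_coe]
  rcases lt_or_ge v u with h | h
  · refine (mul_le_of_le_one_right' prob_le_one).trans (measure_mono_ae ?_)
    filter_upwards [hD.ae_inverse_mono hst] with ω hω hu'
    exact ⟨(h.trans hu').trans_le hω, hu'⟩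
  · obtain ⟨w, rfl⟩ := exists_add_of_le h
    simp only [add_lt_add_iff_left]
    exact (hD.mul_le_measure_lt_inverse_and u w s hst).trans
      (measure_mono fun ω hω => ⟨hω.2, hω.1⟩)

/-- Upper bound for the joint moments of the inverse subordinator. -/
lemma lintegral_inverse_mul_inverse_le (hD : IsStableSubordinator D β P) (ha : 0 < a)
    (s t : ℝ≥0) :
    ∫⁻ ω, ENNReal.ofReal ((measurableInverse D s ω : ℝ) ^ a)
        * ENNReal.ofReal ((measurableInverse D t ω : ℝ) ^ a) ∂P
      ≤ ∫⁻ u, ∫⁻ ω, ENNReal.ofReal ((u + (measurableInverse D t ω : ℝ)) ^ a) ∂P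
          ∂(tailMeasure (fun ω => (measurableInverse D s ω : ℝ)) a P) := by
  have hs := hD.measurable_coe_inverse s
  have ht := hD.measurable_coe_inverse t
  have ht' : Measurable fun p : ℝ × Ω => (measurableInverse D t p.2 : ℝ) :=
    ht.comp measurable_snd
  rw [lintegral_rpow_mul_eq hs (fun ω => NNReal.coe_nonneg _) ha (by fun_prop),
    lintegral_tailMeasure (Measurable.lintegral_prod_right' (f := fun p : ℝ × Ω =>
      ENNReal.ofReal ((p.1 + (measurableInverse D t p.2 : ℝ)) ^ a)) (by fun_prop))]
  refine setLIntegral_mono' measurableSet_Ioi fun u (hu : 0 < u) => ?_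
  rw [mul_right_comm]
  refine mul_le_mul_left ?_ _
  -- For fixed `u`, the factor `P(E(s) > u)` is absorbed into the measure, so that the joint tail
  -- bound becomes a comparison of tails in `v` under two measures.
  rw [← smul_eq_mul (a := P _), ← lintegral_smul_measure]
  refine lintegral_rpow_le_of_tail_le ht (ht.const_add u) (fun ω => NNReal.coe_nonneg _)
    (fun ω => by positivity) ha fun v hv => ?_
  rw [Measure.restrict_apply (measurableSet_lt measurable_const ht), Measure.smul_apply]
  exact hD.measure_lt_coe_inverse_and_le_mul s t hu hv

/-- Lower bound for the joint moments of the inverse subordinator. -/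
lemma le_lintegral_inverse_mul_inverse (hD : IsStableSubordinator D β P) (ha : 0 < a)
    {s t : ℝ≥0} (hst : s ≤ t) :
    ∫⁻ u, ∫⁻ ω, ENNReal.ofReal ((u + (measurableInverse D (t - s) ω : ℝ)) ^ a) ∂P
          ∂(tailMeasure (fun ω => (measurableInverse D s ω : ℝ)) a P)
      ≤ ∫⁻ ω, ENNReal.ofReal ((measurableInverse D s ω : ℝ) ^ a)
        * ENNReal.ofReal ((measurableInverse D t ω : ℝ) ^ a) ∂P := by
  have hs := hD.measurable_coe_inverse s
  have ht := hD.measurable_coe_inverse t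
  have hts := hD.measurable_coe_inverse (t - s)
  have hts' : Measurable fun p : ℝ × Ω => (measurableInverse D (t - s) p.2 : ℝ) :=
    hts.comp measurable_snd
  rw [lintegral_rpow_mul_eq hs (fun ω => NNReal.coe_nonneg _) ha (by fun_prop),
    lintegral_tailMeasure (Measurable.lintegral_prod_right' (f := fun p : ℝ × Ω =>
      ENNReal.ofReal ((p.1 + (measurableInverse D (t - s) p.2 : ℝ)) ^ a)) (by fun_prop))]
  refine setLIntegral_mono' measurableSet_Ioi fun u (hu : 0 < u) => ?_
  rw [mul_right_comm]
  refine mul_le_mul_left ?_ _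
  rw [← smul_eq_mul (a := P _), ← lintegral_smul_measure]
  refine lintegral_rpow_le_of_tail_le (hts.const_add u) ht (fun ω => by positivity)
    (fun ω => NNReal.coe_nonneg _) ha fun v hv => ?_
  rw [Measure.restrict_apply (measurableSet_lt measurable_const ht), Measure.smul_apply]
  exact hD.mul_le_measure_lt_coe_inverse_and hst hu hv

end IsStableSubordinator

/-- Both regimes are merged by the exponent `max (a - 1) 0`. The value of `L` is recorded only for
`1 < a`, the case in which its strict positivity is needed. -/
lemma exists_tendsto_integral_rpow_increment {X : Type*} [MeasurableSpace X] {η : Measure X}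
    {u z : X → ℝ} {a : ℝ} (ha : 0 < a) (hu : Measurable u) (hz : Measurable z)
    (hu0 : ∀ᵐ x ∂η, 0 < u x) (hz0 : ∀ᵐ x ∂η, 0 ≤ z x)
    (hui : Integrable (fun x => u x ^ a) η) (hzi : Integrable (fun x => z x ^ a) η) :
    ∃ L, 0 ≤ L ∧ (1 < a → L = ∫ x, a * u x * z x ^ (a - 1) ∂η) ∧
      Tendsto (fun y : ℝ => y ^ (-max (a - 1) 0) *
        ∫ x, ((u x + y * z x) ^ a - (y * z x) ^ a) ∂η) atTop (𝓝 L) := by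
  rcases lt_or_ge a 1 with h | h
  · obtain ⟨L, hL, hlim⟩ :=
      exists_tendsto_integral_rpow_increment_of_lt_one ha h hu hz hu0 hz0 hui
    refine ⟨L, hL, fun h' => absurd h h'.not_gt, ?_⟩
    simpa [max_eq_right (by linarith : a - 1 ≤ 0)] using hlim
  · refine ⟨_, ?_, fun _ => rfl, ?_⟩
    · refine integral_nonneg_of_ae ?_
      filter_upwards [hu0, hz0] with x hx hx'
      show 0 ≤ _ * _
      positivity
    · rw [max_eq_left (by linarith : 0 ≤ a - 1), neg_sub]
      exact tendsto_integral_rpow_increment_of_one_le h hu hz hu0 hz0 hui hzi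

/-! ### Scaling of moments and covariance asymptotics for the inverse subordinator -/

namespace IsStableSubordinator

variable {Ω : Type*} [MeasurableSpace Ω] {P : Measure Ω} {D : ℝ≥0 → Ω → ℝ} {β a : ℝ}

lemma measurable_snd_inverse (hD : IsStableSubordinator D β P) :
    Measurable fun q : ℝ × Ω => (measurableInverse D 1 q.2 : ℝ) :=
  (hD.measurable_coe_inverse 1).comp measurable_snd

variable [IsProbabilityMeasure P]

lemma map_coe_inverse (hD : IsStableSubordinator D β P) {t : ℝ≥0} (ht : 0 < t) :
    P.map (fun ω => (measurableInverse D t ω : ℝ))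
      = P.map fun ω => (t : ℝ) ^ β * (measurableInverse D 1 ω : ℝ) := by
  have hm1 : Measurable fun ω => t ^ β * measurableInverse D 1 ω :=
    (hD.measurable_inverse 1).const_mul _
  have h := congrArg (Measure.map fun x : ℝ≥0 => (x : ℝ)) (hD.map_inverse ht)
  rw [Measure.map_map measurable_coe_nnreal_real (hD.measurable_inverse t),
    Measure.map_map measurable_coe_nnreal_real hm1] at h
  simpa [Function.comp_def] using h

lemma lintegral_comp_inverse (hD : IsStableSubordinator D β P) {t : ℝ≥0} (ht : 0 < t)
    {g : ℝ → ℝ≥0∞} (hg : Measurable g) :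
    ∫⁻ ω, g (measurableInverse D t ω : ℝ) ∂P
      = ∫⁻ ω, g ((t : ℝ) ^ β * (measurableInverse D 1 ω : ℝ)) ∂P := by
  have hm1 := (hD.measurable_coe_inverse 1).const_mul ((t : ℝ) ^ β)
  rw [← lintegral_map hg (hD.measurable_coe_inverse t), hD.map_coe_inverse ht,
    lintegral_map hg hm1]

lemma integral_inverse_rpow (hD : IsStableSubordinator D β P) {t : ℝ≥0} (ht : 0 < t) (p : ℝ) :
    ∫ ω, (measurableInverse D t ω : ℝ) ^ p ∂P
      = (t : ℝ) ^ (β * p) * ∫ ω, (measurableInverse D 1 ω : ℝ) ^ p ∂P := by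
  have hm1 := (hD.measurable_coe_inverse 1).const_mul ((t : ℝ) ^ β)
  have hg : Measurable fun x : ℝ => x ^ p := by fun_prop
  rw [← integral_map (hD.measurable_coe_inverse t).aemeasurable hg.aestronglyMeasurable,
    hD.map_coe_inverse ht, integral_map hm1.aemeasurable hg.aestronglyMeasurable,
    ← integral_const_mul]
  congr with ω
  rw [Real.mul_rpow (by positivity) (by positivity), Real.rpow_mul (by positivity)]

lemma integrable_inverse_rpow (hD : IsStableSubordinator D β P) (t : ℝ≥0) {p : ℝ} (hp : 0 < p) :
    Integrable (fun ω => (measurableInverse D t ω : ℝ) ^ p) P := by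
  have hm := hD.measurable_coe_inverse t
  refine ⟨(by fun_prop : Measurable _).aestronglyMeasurable, ?_⟩
  rw [hasFiniteIntegral_iff_ofReal (Eventually.of_forall fun ω => by positivity)]
  exact hD.lintegral_inverse_rpow_lt_top t hp

lemma memLp_inverse_rpow (hD : IsStableSubordinator D β P) (t : ℝ≥0) {p : ℝ} (hp : 0 < p) :
    MemLp (fun ω => (measurableInverse D t ω : ℝ) ^ p) 2 P := by
  have hm := hD.measurable_coe_inverse t
  rw [memLp_two_iff_integrable_sq (by fun_prop : Measurable _).aestronglyMeasurable]
  refine (hD.integrable_inverse_rpow t (by linarith : 0 < p * 2)).congr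
    (Eventually.of_forall fun ω => ?_)
  simp only
  rw [Real.rpow_mul (by positivity), Real.rpow_two]

lemma variance_inverse_rpow (hD : IsStableSubordinator D β P) {t : ℝ≥0} (ht : 0 < t) (p : ℝ) :
    variance (fun ω => (measurableInverse D t ω : ℝ) ^ p) P
      = (t : ℝ) ^ (2 * (β * p)) * variance (fun ω => (measurableInverse D 1 ω : ℝ) ^ p) P := by
  have hm1 := (hD.measurable_coe_inverse 1).const_mul ((t : ℝ) ^ β)
  have hg : Measurable fun x : ℝ => x ^ p := by fun_prop
  have h1 : variance (fun ω => (measurableInverse D t ω : ℝ) ^ p) P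
      = variance (fun ω => ((t : ℝ) ^ β * (measurableInverse D 1 ω : ℝ)) ^ p) P := by
    have h := hD.map_coe_inverse ht
    have e1 := variance_map (X := fun x : ℝ => x ^ p) (hg.aemeasurable)
      (hD.measurable_coe_inverse t).aemeasurable (μ := P)
    have e2 := variance_map (X := fun x : ℝ => x ^ p) (hg.aemeasurable) hm1.aemeasurable (μ := P)
    rw [h] at e1
    exact e1.symm.trans e2
  rw [h1, show 2 * (β * p) = β * p * 2 by ring, Real.rpow_mul (by positivity), Real.rpow_two,
    ← variance_const_mul]
  congr with ω
  rw [Real.mul_rpow (by positivity) (by positivity), Real.rpow_mul (by positivity)]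

lemma isFiniteMeasure_tailMeasure (hD : IsStableSubordinator D β P) (ha : 0 < a) (s : ℝ≥0) :
    IsFiniteMeasure (tailMeasure (fun ω => (measurableInverse D s ω : ℝ)) a P) := by
  refine ⟨?_⟩
  rw [tailMeasure_univ (hD.measurable_coe_inverse s) (fun ω => NNReal.coe_nonneg _) ha]
  exact hD.lintegral_inverse_rpow_lt_top s ha

lemma tailMeasure_real_univ (hD : IsStableSubordinator D β P) (ha : 0 < a) (s : ℝ≥0) :
    (tailMeasure (fun ω => (measurableInverse D s ω : ℝ)) a P).real univ
      = ∫ ω, (measurableInverse D s ω : ℝ) ^ a ∂P := by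
  rw [measureReal_def, tailMeasure_univ (hD.measurable_coe_inverse s)
    (fun ω => NNReal.coe_nonneg _) ha, integral_eq_lintegral_of_nonneg_ae
    (Eventually.of_forall fun ω => by positivity)
    (hD.integrable_inverse_rpow s ha).aestronglyMeasurable]

lemma integrable_rpow_tailMeasure (hD : IsStableSubordinator D β P) (ha : 0 < a) (s : ℝ≥0) :
    Integrable (fun u => u ^ a) (tailMeasure (fun ω => (measurableInverse D s ω : ℝ)) a P) := by
  refine ⟨(by fun_prop : Measurable _).aestronglyMeasurable, ?_⟩
  rw [hasFiniteIntegral_iff_ofReal]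
  · exact (lintegral_rpow_tailMeasure_le (hD.measurable_coe_inverse s)
      (fun ω => NNReal.coe_nonneg _) ha).trans_lt
      (hD.lintegral_inverse_rpow_lt_top s (by linarith))
  · filter_upwards [ae_tailMeasure_pos] with u hu
    exact Real.rpow_nonneg hu.le a

/-- The joint law of a time `u`, weighted by the tail of the inverse subordinator at `s`, and of an
independent copy of the inverse subordinator at time one. -/
noncomputable def tailProd (D : ℝ≥0 → Ω → ℝ) (a : ℝ) (P : Measure Ω) (s : ℝ≥0) :
    Measure (ℝ × Ω) :=
  (tailMeasure (fun ω => (measurableInverse D s ω : ℝ)) a P).prod P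

lemma integrable_fst_rpow_tailProd (hD : IsStableSubordinator D β P) (ha : 0 < a) (s : ℝ≥0) :
    Integrable (fun q : ℝ × Ω => q.1 ^ a) (tailProd D a P s) := by
  have := hD.isFiniteMeasure_tailMeasure ha s
  exact (hD.integrable_rpow_tailMeasure ha s).comp_fst P

lemma integrable_snd_rpow_tailProd (hD : IsStableSubordinator D β P) (ha : 0 < a) (s : ℝ≥0) :
    Integrable (fun q : ℝ × Ω => (measurableInverse D 1 q.2 : ℝ) ^ a) (tailProd D a P s) := by
  have := hD.isFiniteMeasure_tailMeasure ha s
  exact (hD.integrable_inverse_rpow 1 ha).comp_snd _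

lemma ae_fst_pos_tailProd (hD : IsStableSubordinator D β P) (ha : 0 < a) (s : ℝ≥0) :
    ∀ᵐ q ∂(tailProd D a P s), 0 < q.1 := by
  have := hD.isFiniteMeasure_tailMeasure ha s
  exact Measure.quasiMeasurePreserving_fst.ae ae_tailMeasure_pos

lemma integrable_tailProd (hD : IsStableSubordinator D β P) (ha : 0 < a) (s : ℝ≥0) {y : ℝ}
    (hy : 0 ≤ y) :
    Integrable (fun q : ℝ × Ω => (q.1 + y * (measurableInverse D 1 q.2 : ℝ)) ^ a)
      (tailProd D a P s) := by
  have hm := hD.measurable_snd_inverse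
  refine (((hD.integrable_fst_rpow_tailProd ha s).add
    ((hD.integrable_snd_rpow_tailProd ha s).const_mul (y ^ a))).const_mul (2 ^ a)).mono'
    (by fun_prop : Measurable _).aestronglyMeasurable ?_
  filter_upwards [hD.ae_fst_pos_tailProd ha s] with q hq
  have h2 : (0 : ℝ) ≤ y * (measurableInverse D 1 q.2 : ℝ) := by positivity
  rw [Real.norm_eq_abs, abs_of_nonneg (by positivity)]
  refine (add_rpow_le_two_rpow_mul ha.le hq.le h2).trans_eq ?_
  rw [Real.mul_rpow hy (by positivity)]
  rfl

lemma integral_snd_rpow_tailProd (hD : IsStableSubordinator D β P) (ha : 0 < a) (s : ℝ≥0) {y : ℝ}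
    (hy : 0 ≤ y) :
    ∫ q, (y * (measurableInverse D 1 q.2 : ℝ)) ^ a ∂(tailProd D a P s)
      = y ^ a * ((∫ ω, (measurableInverse D s ω : ℝ) ^ a ∂P)
        * ∫ ω, (measurableInverse D 1 ω : ℝ) ^ a ∂P) := by
  have := hD.isFiniteMeasure_tailMeasure ha s
  have h := integral_prod_mul (μ := tailMeasure (fun ω => (measurableInverse D s ω : ℝ)) a P)
    (ν := P) (fun _ : ℝ => (1 : ℝ)) fun ω => (y * (measurableInverse D 1 ω : ℝ)) ^ a
  simp only [one_mul, integral_const, smul_eq_mul, mul_one] at h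
  rw [tailProd, h, hD.tailMeasure_real_univ ha]
  simp only [Real.mul_rpow hy (NNReal.coe_nonneg _), integral_const_mul]
  ring

lemma lintegral_lintegral_eq_ofReal (hD : IsStableSubordinator D β P) (ha : 0 < a) (s : ℝ≥0)
    {t : ℝ≥0} (ht : 0 < t) :
    ∫⁻ u, ∫⁻ ω, ENNReal.ofReal ((u + (measurableInverse D t ω : ℝ)) ^ a) ∂P
          ∂(tailMeasure (fun ω => (measurableInverse D s ω : ℝ)) a P)
      = ENNReal.ofReal (∫ q, (q.1 + (t : ℝ) ^ β * (measurableInverse D 1 q.2 : ℝ)) ^ a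
          ∂(tailProd D a P s)) := by
  have hm := hD.measurable_snd_inverse
  have := hD.isFiniteMeasure_tailMeasure ha s
  rw [ofReal_integral_eq_lintegral_ofReal (hD.integrable_tailProd ha s (by positivity)) ?_,
    tailProd, lintegral_prod _ (by fun_prop)]
  · refine lintegral_congr fun u => ?_
    exact hD.lintegral_comp_inverse ht (g := fun x => ENNReal.ofReal ((u + x) ^ a)) (by fun_prop)
  · filter_upwards [hD.ae_fst_pos_tailProd ha s] with q hq
    show 0 ≤ _ ^ a
    positivity

lemma ofReal_integral_inverse_mul_inverse (hD : IsStableSubordinator D β P) (ha : 0 < a)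
    (s t : ℝ≥0) :
    ENNReal.ofReal (∫ ω, (measurableInverse D s ω : ℝ) ^ a * (measurableInverse D t ω : ℝ) ^ a ∂P)
      = ∫⁻ ω, ENNReal.ofReal ((measurableInverse D s ω : ℝ) ^ a)
        * ENNReal.ofReal ((measurableInverse D t ω : ℝ) ^ a) ∂P := by
  have hint : Integrable (fun ω => (measurableInverse D s ω : ℝ) ^ a
      * (measurableInverse D t ω : ℝ) ^ a) P :=
    (hD.memLp_inverse_rpow s ha).integrable_mul (hD.memLp_inverse_rpow t ha)
  rw [ofReal_integral_eq_lintegral_ofReal hint (Eventually.of_forall fun ω => by positivity)]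
  refine lintegral_congr fun ω => ?_
  rw [ENNReal.ofReal_mul (by positivity)]

lemma integral_inverse_mul_inverse_le (hD : IsStableSubordinator D β P) (ha : 0 < a) (s : ℝ≥0)
    {t : ℝ≥0} (ht : 0 < t) :
    ∫ ω, (measurableInverse D s ω : ℝ) ^ a * (measurableInverse D t ω : ℝ) ^ a ∂P
      ≤ ∫ q, (q.1 + (t : ℝ) ^ β * (measurableInverse D 1 q.2 : ℝ)) ^ a ∂(tailProd D a P s) := by
  refine (ENNReal.ofReal_le_ofReal_iff ?_).1 ?_
  · refine integral_nonneg_of_ae ?_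
    filter_upwards [hD.ae_fst_pos_tailProd ha s] with q hq
    show 0 ≤ _ ^ a
    positivity
  · rw [hD.ofReal_integral_inverse_mul_inverse ha, ← hD.lintegral_lintegral_eq_ofReal ha s ht]
    exact hD.lintegral_inverse_mul_inverse_le ha s t

lemma le_integral_inverse_mul_inverse (hD : IsStableSubordinator D β P) (ha : 0 < a) {s t : ℝ≥0}
    (hst : s < t) :
    ∫ q, (q.1 + ((t - s : ℝ≥0) : ℝ) ^ β * (measurableInverse D 1 q.2 : ℝ)) ^ a ∂(tailProd D a P s)
      ≤ ∫ ω, (measurableInverse D s ω : ℝ) ^ a * (measurableInverse D t ω : ℝ) ^ a ∂P := by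
  refine (ENNReal.ofReal_le_ofReal_iff (integral_nonneg fun ω => by positivity)).1 ?_
  rw [hD.ofReal_integral_inverse_mul_inverse ha,
    ← hD.lintegral_lintegral_eq_ofReal ha s (tsub_pos_of_lt hst)]
  exact hD.le_lintegral_inverse_mul_inverse ha hst.le

/-- Asymptotics of the covariance of powers of the inverse stable subordinator. -/
theorem exists_tendsto_covariance_inverse (hD : IsStableSubordinator D β P) (ha : 0 < a)
    (hβ : 0 < β) (haβ : a * β < 1) {s : ℝ≥0} (hs : 0 < s) :
    ∃ L, 0 ≤ L ∧ (1 < a → L = ∫ q, a * q.1 * (measurableInverse D 1 q.2 : ℝ) ^ (a - 1)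
        ∂(tailProd D a P s)) ∧
      Tendsto (fun t : ℝ≥0 => (t : ℝ) ^ (-(β * max (a - 1) 0)) *
        covariance (fun ω => (measurableInverse D s ω : ℝ) ^ a)
          (fun ω => (measurableInverse D t ω : ℝ) ^ a) P) atTop (𝓝 L) := by
  have hm := hD.measurable_snd_inverse
  set r := max (a - 1) 0 with hr
  have hr0 : 0 ≤ r := le_max_right _ _
  obtain ⟨L, hL0, hL1, hL⟩ := exists_tendsto_integral_rpow_increment (η := tailProd D a P s) ha
    measurable_fst hm (hD.ae_fst_pos_tailProd ha s) (Eventually.of_forall fun q => by positivity)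
    (hD.integrable_fst_rpow_tailProd ha s) (hD.integrable_snd_rpow_tailProd ha s)
  rw [← hr] at hL
  refine ⟨L, hL0, hL1, ?_⟩
  set F : ℝ → ℝ := fun y => ∫ q, ((q.1 + y * (measurableInverse D 1 q.2 : ℝ)) ^ a
    - (y * (measurableInverse D 1 q.2 : ℝ)) ^ a) ∂(tailProd D a P s) with hF
  set A := ∫ ω, (measurableInverse D s ω : ℝ) ^ a ∂P with hA
  set m := ∫ ω, (measurableInverse D 1 ω : ℝ) ^ a ∂P with hmdef
  have hFeq : ∀ y, 0 ≤ y → ∫ q, (q.1 + y * (measurableInverse D 1 q.2 : ℝ)) ^ a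
      ∂(tailProd D a P s) = F y + y ^ a * (A * m) := fun y hy => by
    rw [← hD.integral_snd_rpow_tailProd ha s hy]
    simp only [hF]
    rw [integral_sub (hD.integrable_tailProd ha s hy)]
    · ring
    · simp only [Real.mul_rpow hy (NNReal.coe_nonneg _)]
      exact (hD.integrable_snd_rpow_tailProd ha s).const_mul _
  have hcov : ∀ t : ℝ≥0, 0 < t → covariance (fun ω => (measurableInverse D s ω : ℝ) ^ a)
      (fun ω => (measurableInverse D t ω : ℝ) ^ a) P
      = (∫ ω, (measurableInverse D s ω : ℝ) ^ a * (measurableInverse D t ω : ℝ) ^ a ∂P)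
        - (t : ℝ) ^ (β * a) * (A * m) := fun t ht => by
    rw [covariance_eq_sub (hD.memLp_inverse_rpow s ha) (hD.memLp_inverse_rpow t ha),
      hD.integral_inverse_rpow ht, ← hA, ← hmdef]
    simp only [Pi.mul_apply]
    ring
  have hcoe : Tendsto (fun t : ℝ≥0 => (t : ℝ)) atTop atTop := NNReal.tendsto_coe_atTop.2 tendsto_id
  have hsub : Tendsto (fun t : ℝ => t - s) atTop atTop :=
    tendsto_atTop_add_const_right _ _ tendsto_id
  have hLβ : Tendsto (fun t : ℝ => t ^ (-(β * r)) * F (t ^ β)) atTop (𝓝 L) := by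
    refine (hL.comp (tendsto_rpow_atTop hβ)).congr' ?_
    filter_upwards [eventually_ge_atTop 0] with t ht
    simp only [Function.comp_apply]
    rw [← Real.rpow_mul ht, mul_neg]
  have hratio : Tendsto (fun t : ℝ => ((t - s) / t) ^ (β * r)) atTop (𝓝 1) := by
    have h1 : Tendsto (fun t : ℝ => (t - s) / t) atTop (𝓝 1) := by
      have h0 : Tendsto (fun t : ℝ => 1 - (s : ℝ) / t) atTop (𝓝 (1 - 0)) :=
        (tendsto_const_nhds.div_atTop tendsto_id).const_sub 1
      rw [sub_zero] at h0
      refine h0.congr' ?_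
      filter_upwards [eventually_gt_atTop 0] with t ht
      field_simp
    have := h1.rpow_const (p := β * r) (Or.inl one_ne_zero)
    simpa using this
  -- The lower bound features `E(t - s)` whereas the covariance is normalised and centred at `t`:
  -- the ratio corrects the normalisation, the subtracted term the centring.
  have hlow : Tendsto (fun t : ℝ => ((t - s) / t) ^ (β * r) *
      ((t - s) ^ (-(β * r)) * F ((t - s) ^ β))
      - t ^ (-(β * r)) * ((t ^ (a * β) - (t - s) ^ (a * β)) * (A * m))) atTop (𝓝 L) := by
    have h1 := hratio.mul (hLβ.comp hsub)
    -- This is where `a * β < 1` enters: the centring error is an increment of a sublinear power.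
    have h2 : Tendsto (fun t : ℝ => t ^ (-(β * r)) *
        ((t ^ (a * β) - (t - s) ^ (a * β)) * (A * m))) atTop (𝓝 0) := by
      have h3 := (tendsto_rpow_sub_rpow_sub (mul_pos ha hβ) haβ s.2).mul_const (A * m)
      rw [zero_mul] at h3
      refine squeeze_zero_norm' ?_ (tendsto_zero_iff_norm_tendsto_zero.1 h3)
      filter_upwards [eventually_ge_atTop 1] with t ht
      rw [norm_mul, Real.norm_of_nonneg (by positivity)]
      exact mul_le_of_le_one_left (norm_nonneg _)
        (Real.rpow_le_one_of_one_le_of_nonpos ht (neg_nonpos.2 (by positivity)))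
    simpa using h1.sub h2
  refine tendsto_of_tendsto_of_tendsto_of_le_of_le' (hlow.comp hcoe) (hLβ.comp hcoe) ?_ ?_
  · filter_upwards [eventually_gt_atTop s] with t hst
    have ht : 0 < t := hs.trans hst
    have ht' : (0 : ℝ) < t := ht
    have hts : (0 : ℝ) < t - s := sub_pos.2 (by exact_mod_cast hst)
    have h := hD.le_integral_inverse_mul_inverse ha hst
    rw [NNReal.coe_sub hst.le, hFeq _ (by positivity), ← Real.rpow_mul hts.le] at h
    simp only [Function.comp_apply]
    rw [hcov t ht, Real.div_rpow hts.le ht'.le, Real.rpow_neg hts.le, Real.rpow_neg ht'.le]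
    have hp1 : ((t : ℝ) - s) ^ (β * r) ≠ 0 := (Real.rpow_pos_of_pos hts _).ne'
    have hp2 : (0 : ℝ) < ((t : ℝ) ^ (β * r))⁻¹ := by positivity
    have heq : ((t : ℝ) - s) ^ (β * r) / (t : ℝ) ^ (β * r) *
        (((t : ℝ) - s) ^ (β * r))⁻¹ * F (((t : ℝ) - s) ^ β)
        = ((t : ℝ) ^ (β * r))⁻¹ * F (((t : ℝ) - s) ^ β) := by field_simp
    rw [← mul_assoc, heq, ← mul_sub]
    refine mul_le_mul_of_nonneg_left ?_ hp2.le
    rw [mul_comm a β]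
    linarith
  · filter_upwards [eventually_gt_atTop 0] with t ht
    have ht' : (0 : ℝ) < t := ht
    have h := hD.integral_inverse_mul_inverse_le ha s ht
    rw [hFeq _ (by positivity), ← Real.rpow_mul ht'.le] at h
    simp only [Function.comp_apply]
    rw [hcov t ht]
    refine mul_le_mul_of_nonneg_left ?_ (by positivity)
    linarith

/-! ### Nondegeneracy for `β < 1` and the degenerate case `β = 1` -/

/-- The inverse of a stable subordinator of index `β < 1` is not deterministic. -/
lemma not_ae_eq_const_inverse (hD : IsStableSubordinator D β P) (hβ1 : β < 1) (c : ℝ≥0) :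
    ¬ ∀ᵐ ω ∂P, measurableInverse D 1 ω = c := by
  intro h
  have hgt : ∀ᵐ ω ∂P, 1 < D (c + 1) ω := by
    filter_upwards [h, hD.ae_lt_inverse_iff] with ω hω hiff
    by_contra! hle
    exact lt_irrefl c (hω ▸ (hiff 1 c).2 ⟨c + 1, by simp, by simpa using hle⟩)
  -- If `D (c + 1) > 1` almost surely, its Laplace transform is at most `exp (-s)`. The resulting
  -- linear bound contradicts `β < 1` for large `s`.
  have hle : ∀ s : ℝ≥0, (s : ℝ) ≤ (c + 1) * (s : ℝ) ^ β := fun s => by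
    have h1 := hD.laplace (c + 1) s
    have h2 : ∫ ω, Real.exp (-(s * D (c + 1) ω)) ∂P ≤ ∫ _, Real.exp (-s) ∂P := by
      refine integral_mono_ae (hD.integrable_exp_neg _ s.2) (integrable_const _) ?_
      filter_upwards [hgt] with ω hω
      refine Real.exp_le_exp.2 (neg_le_neg ?_)
      exact le_mul_of_one_le_right s.2 hω.le
    rw [h1, integral_const, probReal_univ, one_smul, Real.exp_le_exp, neg_le_neg_iff] at h2
    simpa using h2
  -- Chosen so that `s = (c + 2) s ^ β`, which exceeds the bound just obtained.
  set s : ℝ≥0 := (c + 2) ^ (1 / (1 - β)) with hs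
  have hspos : (0 : ℝ) < s := by
    rw [hs]
    exact_mod_cast NNReal.rpow_pos (by positivity : 0 < c + 2)
  have hpow : (s : ℝ) ^ (1 - β) = c + 2 := by
    rw [hs, NNReal.coe_rpow, ← Real.rpow_mul (by positivity),
      one_div_mul_cancel (by linarith), Real.rpow_one]
    simp
  have hsplit : (s : ℝ) = (c + 2) * (s : ℝ) ^ β := by
    rw [← hpow, ← Real.rpow_add hspos]
    simp
  have := hle s
  have hposβ : 0 < (s : ℝ) ^ β := Real.rpow_pos_of_pos hspos β
  nlinarith

lemma variance_inverse_rpow_pos (hD : IsStableSubordinator D β P) (ha : 0 < a) (hβ1 : β < 1) :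
    0 < variance (fun ω => (measurableInverse D 1 ω : ℝ) ^ a) P := by
  refine (variance_nonneg _ _).lt_of_ne fun h => ?_
  have hconst := ae_eq_integral_of_variance_eq_zero (hD.memLp_inverse_rpow 1 ha) h.symm
  set m := ∫ ω, (measurableInverse D 1 ω : ℝ) ^ a ∂P
  refine hD.not_ae_eq_const_inverse hβ1 (Real.toNNReal (m ^ a⁻¹)) ?_
  filter_upwards [hconst] with ω hω
  rw [← hω, Real.rpow_rpow_inv (by positivity) ha.ne', Real.toNNReal_coe]

lemma integral_inverse_one_rpow_pos (hD : IsStableSubordinator D β P) (ha : 0 < a)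
    (hβ1 : β < 1) : 0 < ∫ ω, (measurableInverse D 1 ω : ℝ) ^ a ∂P := by
  refine (integral_nonneg fun ω => by positivity).lt_of_ne fun h => ?_
  have h0 := (integral_eq_zero_iff_of_nonneg (fun ω => by positivity)
    (hD.integrable_inverse_rpow 1 ha)).1 h.symm
  refine hD.not_ae_eq_const_inverse hβ1 0 ?_
  filter_upwards [h0] with ω hω
  simpa [Real.rpow_eq_zero (NNReal.coe_nonneg _) ha.ne'] using hω

lemma integral_tailProd_pos (hD : IsStableSubordinator D β P) (ha : 1 < a) (hβ1 : β < 1)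
    {s : ℝ≥0} (hs : 0 < s) :
    0 < ∫ q, a * q.1 * (measurableInverse D 1 q.2 : ℝ) ^ (a - 1) ∂(tailProd D a P s) := by
  have ha0 : 0 < a := by linarith
  have := hD.isFiniteMeasure_tailMeasure ha0 s
  set ρ := tailMeasure (fun ω => (measurableInverse D s ω : ℝ)) a P with hρ
  rw [tailProd, integral_prod_mul (fun u : ℝ => a * u)
    fun ω => (measurableInverse D 1 ω : ℝ) ^ (a - 1)]
  refine mul_pos ?_ (hD.integral_inverse_one_rpow_pos (by linarith) hβ1)
  have hint : Integrable (fun u : ℝ => a * u) ρ := by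
    refine Integrable.const_mul ?_ a
    refine ((integrable_const (1 : ℝ)).add (hD.integrable_rpow_tailMeasure ha0 s)).mono'
      (by fun_prop) ?_
    filter_upwards [ae_tailMeasure_pos] with u hu
    rw [Real.norm_eq_abs, abs_of_pos hu]
    simp only [Pi.add_apply]
    rcases le_total u 1 with h | h
    · linarith [Real.rpow_nonneg hu.le a]
    · linarith [Real.self_le_rpow_of_one_le h ha.le]
  have hpos : ∀ᵐ u ∂ρ, 0 < a * u := by
    filter_upwards [ae_tailMeasure_pos] with u hu
    positivity
  rw [integral_pos_iff_support_of_nonneg_ae (hpos.mono fun u hu => hu.le) hint]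
  have hsupp : ρ (Function.support fun u => a * u) = ρ univ :=
    measure_congr (eventuallyEq_univ.2 (hpos.mono fun u hu => hu.ne'))
  rw [hsupp]
  have h1 := hD.tailMeasure_real_univ ha0 s
  rw [hD.integral_inverse_rpow hs] at h1
  have h2 : 0 < ρ.real univ := by
    rw [h1]
    have hs' : (0 : ℝ) < s := hs
    exact mul_pos (by positivity) (hD.integral_inverse_one_rpow_pos ha0 hβ1)
  exact (ENNReal.toReal_pos_iff.1 h2).1

/-- The stable subordinator of index one is the identity. -/
lemma ae_eq_self (hD : IsStableSubordinator D 1 P) (t : ℝ≥0) : ∀ᵐ ω ∂P, D t ω = t := by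
  have h1 := hD.laplace t 1
  have h2 := hD.laplace t 2
  have hsq : ∀ x : ℝ, Real.exp (-x) ^ 2 = Real.exp (-(2 * x)) := fun x => by
    rw [← Real.exp_nat_mul]; push_cast; ring_nf
  have hm := hD.measurable t
  have hL : MemLp (fun ω => Real.exp (-D t ω)) 2 P := by
    rw [memLp_two_iff_integrable_sq (by fun_prop)]
    simp only [hsq]
    exact hD.integrable_exp_neg t zero_le_two
  -- For `β = 1` the Laplace transform at `2` is the square of that at `1`, so `exp (-D t)` is
  -- almost surely constant.
  have hv : variance (fun ω => Real.exp (-D t ω)) P = 0 := by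
    rw [variance_eq_sub hL]
    simp only [Pi.pow_apply, hsq]
    simp only [NNReal.coe_one, one_mul, mul_one, NNReal.coe_ofNat,
      Real.rpow_one] at h1 h2
    rw [h1, h2, hsq, mul_comm, sub_self]
  filter_upwards [ae_eq_integral_of_variance_eq_zero hL hv] with ω hω
  simp only [NNReal.coe_one, one_mul, Real.one_rpow, mul_one] at h1
  rw [h1, Real.exp_eq_exp, neg_inj] at hω
  exact hω

lemma ae_inverse_eq_self (hD : IsStableSubordinator D 1 P) (t : ℝ≥0) :
    ∀ᵐ ω ∂P, measurableInverse D t ω = t := by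
  filter_upwards [hD.ae_lt_inverse_iff, hD.monotone_paths, hD.ae_eq_self t,
    ae_all_iff.2 fun n : ℕ => hD.ae_eq_self (t + 1 / (n + 1))] with ω hiff hm ht hn
  refine le_antisymm (not_lt.1 fun h => ?_) (not_lt.1 fun h => ?_)
  · obtain ⟨r, htr, hr⟩ := (hiff t t).1 h
    have hlim : Tendsto (fun n : ℕ => t + (1 : ℝ≥0) / (n + 1)) atTop (𝓝 t) := by
      have : Tendsto (fun n : ℕ => (1 : ℝ≥0) / (n + 1)) atTop (𝓝 0) :=
        tendsto_one_div_add_atTop_nhds_zero_nat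
      simpa using this.const_add t
    obtain ⟨n, hnr⟩ := (hlim.eventually_lt_const htr).exists
    have h1 := (hm hnr.le).trans hr
    simp only [hn n, NNReal.coe_le_coe] at h1
    have : (0 : ℝ≥0) < 1 / (n + 1) := by positivity
    exact (lt_add_of_pos_right t this).not_ge h1
  · exact lt_irrefl _ ((hiff t _).2 ⟨t, h, ht.le⟩)

end IsStableSubordinator

/-! ### Second-order structure of the fractional non-homogeneous Poisson process -/

lemma fnpp_nonneg {Ω : Type*} (N : ℝ≥0 → Ω → ℕ) (Λ : ℝ≥0 → ℝ≥0) (D : ℝ≥0 → Ω → ℝ) (t : ℝ≥0) (ω : Ω) :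
    0 ≤ fnpp N Λ D t ω := Nat.cast_nonneg _

lemma coe_weibullRate (a : ℝ) (b x : ℝ≥0) :
    ((weibullRate a b x : ℝ≥0) : ℝ) = ((b : ℝ) ^ a)⁻¹ * (x : ℝ) ^ a := by
  rw [weibullRate, NNReal.div_rpow, NNReal.coe_div, NNReal.coe_rpow, NNReal.coe_rpow,
    div_eq_inv_mul]

lemma measurable_weibullRate (a : ℝ) (b : ℝ≥0) : Measurable (weibullRate a b) := by
  unfold weibullRate
  fun_prop

lemma weibullRate_mono (ha : 0 ≤ a) (b : ℝ≥0) : Monotone (weibullRate a b) := fun x y hxy => by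
  unfold weibullRate
  gcongr

section Fnpp

variable {Ω : Type*} [MeasurableSpace Ω] {P : Measure Ω}
  {N : ℝ≥0 → Ω → ℕ} {D : ℝ≥0 → Ω → ℝ} {a β : ℝ} {b : ℝ≥0}

lemma indepFun_weibullRate_inverse (hND : IndepFun (fun ω t => N t ω) (fun ω t => D t ω) P)
    (s t : ℝ≥0) :
    IndepFun (fun ω t => N t ω) (fun ω => (weibullRate a b (measurableInverse D s ω),
      weibullRate a b (measurableInverse D t ω))) P :=
  hND.comp (φ := id) (ψ := fun f => (weibullRate a b (pathInverse s f),
    weibullRate a b (pathInverse t f))) measurable_id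
    (((measurable_weibullRate a b).comp (measurable_pathInverse s)).prodMk
      ((measurable_weibullRate a b).comp (measurable_pathInverse t)))

variable [IsProbabilityMeasure P]

lemma ae_fnpp_eq (hD : IsStableSubordinator D β P) :
    ∀ᵐ ω ∂P, ∀ t, fnpp N (weibullRate a b) D t ω
      = N (weibullRate a b (measurableInverse D t ω)) ω := by
  filter_upwards [hD.ae_inverse_eq] with ω h t
  rw [fnpp, h]

lemma aemeasurable_fnpp (hN : IsPoissonProcess N 1 P) (hD : IsStableSubordinator D β P)
    (t : ℝ≥0) : AEMeasurable (fnpp N (weibullRate a b) D t) P := by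
  have h := hN.aemeasurable_comp ((measurable_weibullRate a b).comp
    (hD.measurable_inverse t)).aemeasurable
  have hc : Measurable fun n : ℕ => (n : ℝ) := measurable_from_top
  refine (hc.comp_aemeasurable h).congr ?_
  filter_upwards [ae_fnpp_eq (N := N) (a := a) (b := b) hD] with ω hω
  exact (hω t).symm

lemma lintegral_fnpp (hN : IsPoissonProcess N 1 P) (hD : IsStableSubordinator D β P)
    (hND : IndepFun (fun ω t => N t ω) (fun ω t => D t ω) P) (t : ℝ≥0) :
    ∫⁻ ω, ENNReal.ofReal (fnpp N (weibullRate a b) D t ω) ∂P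
      = ∫⁻ ω, ENNReal.ofReal (((b : ℝ) ^ a)⁻¹ * (measurableInverse D t ω : ℝ) ^ a) ∂P := by
  have hm := (measurable_weibullRate a b).comp (hD.measurable_inverse t)
  have h := hN.lintegral_natCast_comp hm (indepFun_weibullRate_inverse hND t t)
  simp only [Function.comp_apply] at h
  simp only [← coe_weibullRate, ENNReal.ofReal_coe_nnreal]
  rw [← h]
  refine lintegral_congr_ae ?_
  filter_upwards [ae_fnpp_eq (N := N) (a := a) (b := b) hD] with ω hω
  rw [hω, ENNReal.ofReal_natCast]

lemma lintegral_fnpp_mul (hN : IsPoissonProcess N 1 P) (hD : IsStableSubordinator D β P)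
    (hND : IndepFun (fun ω t => N t ω) (fun ω t => D t ω) P) (ha : 0 < a) {s t : ℝ≥0}
    (hst : s ≤ t) :
    ∫⁻ ω, ENNReal.ofReal (fnpp N (weibullRate a b) D s ω * fnpp N (weibullRate a b) D t ω) ∂P
      = ∫⁻ ω, ENNReal.ofReal (((b : ℝ) ^ a)⁻¹ * (measurableInverse D s ω : ℝ) ^ a
        + (((b : ℝ) ^ a)⁻¹) ^ 2 * ((measurableInverse D s ω : ℝ) ^ a
          * (measurableInverse D t ω : ℝ) ^ a)) ∂P := by
  have hms := (measurable_weibullRate a b).comp (hD.measurable_inverse s)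
  have hmt := (measurable_weibullRate a b).comp (hD.measurable_inverse t)
  have h := hN.lintegral_natCast_comp_mul hms hmt (indepFun_weibullRate_inverse hND s t) (by
    filter_upwards [hD.ae_inverse_mono hst] with ω hω using weibullRate_mono ha.le b hω)
  simp only [Function.comp_apply] at h
  calc _ = ∫⁻ ω, (N (weibullRate a b (measurableInverse D s ω)) ω : ℝ≥0∞)
        * N (weibullRate a b (measurableInverse D t ω)) ω ∂P := by
        refine lintegral_congr_ae ?_
        filter_upwards [ae_fnpp_eq (N := N) (a := a) (b := b) hD] with ω hω
        rw [hω, hω, ← Nat.cast_mul, ENNReal.ofReal_natCast, Nat.cast_mul]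
    _ = _ := by
        rw [h]
        refine lintegral_congr fun ω => ?_
        rw [← ENNReal.coe_mul, ← ENNReal.coe_add, ← ENNReal.ofReal_coe_nnreal]
        congr 1
        push_cast
        rw [coe_weibullRate, coe_weibullRate]
        ring

lemma integrable_inverse_add (hD : IsStableSubordinator D β P) (ha : 0 < a) (κ : ℝ) (s t : ℝ≥0) :
    Integrable (fun ω => κ * (measurableInverse D s ω : ℝ) ^ a
      + κ ^ 2 * ((measurableInverse D s ω : ℝ) ^ a * (measurableInverse D t ω : ℝ) ^ a)) P :=
  ((hD.integrable_inverse_rpow s ha).const_mul κ).add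
    (((hD.memLp_inverse_rpow s ha).integrable_mul (hD.memLp_inverse_rpow t ha)).const_mul (κ ^ 2))

/-- The fractional non-homogeneous Poisson process is square integrable. -/
lemma memLp_fnpp (hN : IsPoissonProcess N 1 P) (hD : IsStableSubordinator D β P)
    (hND : IndepFun (fun ω t => N t ω) (fun ω t => D t ω) P) (ha : 0 < a) (t : ℝ≥0) :
    MemLp (fnpp N (weibullRate a b) D t) 2 P := by
  have hm : AEMeasurable (fnpp N (weibullRate a b) D t) P := aemeasurable_fnpp hN hD t
  rw [memLp_two_iff_integrable_sq hm.aestronglyMeasurable]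
  refine ⟨(hm.pow_const 2).aestronglyMeasurable, ?_⟩
  rw [hasFiniteIntegral_iff_ofReal (Eventually.of_forall fun ω => sq_nonneg _)]
  simp only [sq]
  rw [lintegral_fnpp_mul hN hD hND ha le_rfl]
  exact (integrable_inverse_add hD ha _ t t).lintegral_lt_top

lemma integral_fnpp (hN : IsPoissonProcess N 1 P) (hD : IsStableSubordinator D β P)
    (hND : IndepFun (fun ω t => N t ω) (fun ω t => D t ω) P) (ha : 0 < a) (t : ℝ≥0) :
    ∫ ω, fnpp N (weibullRate a b) D t ω ∂P
      = ((b : ℝ) ^ a)⁻¹ * ∫ ω, (measurableInverse D t ω : ℝ) ^ a ∂P := by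
  rw [← integral_const_mul, integral_eq_lintegral_of_nonneg_ae
    (Eventually.of_forall fun ω => fnpp_nonneg _ _ _ _ _)
    (aemeasurable_fnpp hN hD t).aestronglyMeasurable, lintegral_fnpp hN hD hND,
    integral_eq_lintegral_of_nonneg_ae (Eventually.of_forall fun ω => by positivity)
    ((hD.integrable_inverse_rpow t ha).const_mul _).aestronglyMeasurable]

lemma integral_fnpp_mul (hN : IsPoissonProcess N 1 P) (hD : IsStableSubordinator D β P)
    (hND : IndepFun (fun ω t => N t ω) (fun ω t => D t ω) P) (ha : 0 < a) {s t : ℝ≥0}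
    (hst : s ≤ t) :
    ∫ ω, fnpp N (weibullRate a b) D s ω * fnpp N (weibullRate a b) D t ω ∂P
      = ((b : ℝ) ^ a)⁻¹ * (∫ ω, (measurableInverse D s ω : ℝ) ^ a ∂P)
        + (((b : ℝ) ^ a)⁻¹) ^ 2 * ∫ ω, (measurableInverse D s ω : ℝ) ^ a
          * (measurableInverse D t ω : ℝ) ^ a ∂P := by
  have hint : Integrable (fun ω => (measurableInverse D s ω : ℝ) ^ a
      * (measurableInverse D t ω : ℝ) ^ a) P :=
    (hD.memLp_inverse_rpow s ha).integrable_mul (hD.memLp_inverse_rpow t ha)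
  rw [← integral_const_mul, ← integral_const_mul,
    ← integral_add ((hD.integrable_inverse_rpow s ha).const_mul _) (hint.const_mul _),
    integral_eq_lintegral_of_nonneg_ae
    (Eventually.of_forall fun ω => mul_nonneg (fnpp_nonneg _ _ _ _ _) (fnpp_nonneg _ _ _ _ _))
    ((aemeasurable_fnpp hN hD s).mul (aemeasurable_fnpp hN hD t)).aestronglyMeasurable,
    lintegral_fnpp_mul hN hD hND ha hst,
    integral_eq_lintegral_of_nonneg_ae (Eventually.of_forall fun ω => by positivity)
    (integrable_inverse_add hD ha _ s t).aestronglyMeasurable]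

/-- The covariance of the fractional non-homogeneous Poisson process. -/
lemma covariance_fnpp (hN : IsPoissonProcess N 1 P) (hD : IsStableSubordinator D β P)
    (hND : IndepFun (fun ω t => N t ω) (fun ω t => D t ω) P) (ha : 0 < a) {s t : ℝ≥0}
    (hst : s ≤ t) :
    covariance (fnpp N (weibullRate a b) D s) (fnpp N (weibullRate a b) D t) P
      = ((b : ℝ) ^ a)⁻¹ * (∫ ω, (measurableInverse D s ω : ℝ) ^ a ∂P)
        + (((b : ℝ) ^ a)⁻¹) ^ 2 * covariance (fun ω => (measurableInverse D s ω : ℝ) ^ a)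
          (fun ω => (measurableInverse D t ω : ℝ) ^ a) P := by
  rw [covariance_eq_sub (memLp_fnpp hN hD hND ha s) (memLp_fnpp hN hD hND ha t),
    covariance_eq_sub (hD.memLp_inverse_rpow s ha) (hD.memLp_inverse_rpow t ha),
    integral_fnpp hN hD hND ha, integral_fnpp hN hD hND ha]
  simp only [Pi.mul_apply]
  rw [integral_fnpp_mul hN hD hND ha hst]
  ring

lemma variance_fnpp (hN : IsPoissonProcess N 1 P) (hD : IsStableSubordinator D β P)
    (hND : IndepFun (fun ω t => N t ω) (fun ω t => D t ω) P) (ha : 0 < a) (t : ℝ≥0) :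
    variance (fnpp N (weibullRate a b) D t) P
      = ((b : ℝ) ^ a)⁻¹ * (∫ ω, (measurableInverse D t ω : ℝ) ^ a ∂P)
        + (((b : ℝ) ^ a)⁻¹) ^ 2 * variance (fun ω => (measurableInverse D t ω : ℝ) ^ a) P := by
  have hm : AEMeasurable (fun ω => (measurableInverse D t ω : ℝ) ^ a) P :=
    ((hD.measurable_coe_inverse t).pow_const a).aemeasurable
  rw [← covariance_self (aemeasurable_fnpp hN hD t), covariance_fnpp hN hD hND ha le_rfl,
    covariance_self hm]

end Fnpp

/-- Power asymptotics of covariances and variances give power asymptotics of correlations. -/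
lemma tendsto_correlation_div_rpow {Ω : Type*} [MeasurableSpace Ω] {P : Measure Ω}
    {X : ℝ≥0 → Ω → ℝ} {s : ℝ≥0} {p q C V : ℝ} (hC : 0 < C) (hV : 0 < V)
    (hs : 0 < variance (X s) P)
    (hcov : Tendsto (fun t : ℝ≥0 => (t : ℝ) ^ (-q) * covariance (X s) (X t) P) atTop (𝓝 C))
    (hvar : Tendsto (fun t : ℝ≥0 => (t : ℝ) ^ (-(2 * p)) * variance (X t) P) atTop (𝓝 V)) :
    ∃ c : ℝ, 0 < c ∧
      Tendsto (fun t : ℝ≥0 => correlation (X s) (X t) P / (t : ℝ) ^ (-(p - q))) atTop (𝓝 c) := by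
  refine ⟨C / Real.sqrt (variance (X s) P * V), by positivity, ?_⟩
  have h := hcov.div (hvar.const_mul (variance (X s) P)).sqrt (by positivity)
  refine h.congr' ?_
  filter_upwards [eventually_gt_atTop 0] with t ht
  have ht' : (0 : ℝ) < t := ht
  have hpp : ((t : ℝ) ^ (-(2 * p))) = ((t : ℝ) ^ (-p)) ^ 2 := by
    rw [← Real.rpow_natCast, ← Real.rpow_mul ht'.le]
    congr 1
    push_cast
    ring
  have hsq : Real.sqrt (variance (X s) P * ((t : ℝ) ^ (-(2 * p)) * variance (X t) P))
      = (t : ℝ) ^ (-p) * Real.sqrt (variance (X s) P * variance (X t) P) := by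
    rw [mul_left_comm, Real.sqrt_mul (by positivity), hpp, Real.sqrt_sq (by positivity)]
  have hq : (t : ℝ) ^ (-q) = (t : ℝ) ^ (-p) * (t : ℝ) ^ (p - q) := by
    rw [← Real.rpow_add ht']
    congr 1
    ring
  have hne : (t : ℝ) ^ (-p) ≠ 0 := (Real.rpow_pos_of_pos ht' _).ne'
  simp only [Pi.div_apply, correlation]
  rw [hsq, hq, Real.rpow_neg ht'.le (p - q), div_inv_eq_mul, mul_assoc,
    mul_div_mul_left _ _ hne]
  ring

/-! ### The cases `β < 1` and `β = 1` -/

section Main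

variable {Ω : Type*} [MeasurableSpace Ω] {P : Measure Ω} [IsProbabilityMeasure P]
  {N : ℝ≥0 → Ω → ℕ} {D : ℝ≥0 → Ω → ℝ} {a β : ℝ} {b : ℝ≥0}

lemma hasLongRangeDependence_fnpp_of_lt_one (ha : 0 < a) (hb : 0 < b) (hβ : 0 < β) (hβ1 : β < 1)
    (haβ : a * β < 1) (hN : IsPoissonProcess N 1 P) (hD : IsStableSubordinator D β P)
    (hND : IndepFun (fun ω t => N t ω) (fun ω t => D t ω) P) :
    HasLongRangeDependence (fnpp N (weibullRate a b) D) P := by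
  set κ : ℝ := ((b : ℝ) ^ a)⁻¹ with hκdef
  have hκ : 0 < κ := inv_pos.2 (Real.rpow_pos_of_pos hb a)
  set m := ∫ ω, (measurableInverse D 1 ω : ℝ) ^ a ∂P with hmdef
  have hm : 0 < m := hD.integral_inverse_one_rpow_pos ha hβ1
  set V := variance (fun ω => (measurableInverse D 1 ω : ℝ) ^ a) P with hVdef
  have hV : 0 < V := hD.variance_inverse_rpow_pos ha hβ1
  have hvar : ∀ t : ℝ≥0, 0 < t → variance (fnpp N (weibullRate a b) D t) P
      = κ * ((t : ℝ) ^ (β * a) * m) + κ ^ 2 * ((t : ℝ) ^ (2 * (β * a)) * V) := fun t ht => by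
    rw [variance_fnpp hN hD hND ha, hD.integral_inverse_rpow ht, hD.variance_inverse_rpow ht]
  have hcoe : Tendsto (fun t : ℝ≥0 => (t : ℝ)) atTop atTop := NNReal.tendsto_coe_atTop.2 tendsto_id
  have hvarlim : Tendsto (fun t : ℝ≥0 => (t : ℝ) ^ (-(2 * (β * a)))
      * variance (fnpp N (weibullRate a b) D t) P) atTop (𝓝 (κ ^ 2 * V)) := by
    have h0 : Tendsto (fun t : ℝ≥0 => κ * m * (t : ℝ) ^ (-(β * a)) + κ ^ 2 * V) atTop
        (𝓝 (κ * m * 0 + κ ^ 2 * V)) :=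
      (((tendsto_rpow_neg_atTop (mul_pos hβ ha)).comp hcoe).const_mul _).add_const _
    rw [mul_zero, zero_add] at h0
    refine h0.congr' ?_
    filter_upwards [eventually_gt_atTop 0] with t ht
    have ht' : (0 : ℝ) < t := ht
    have h2 : (t : ℝ) ^ (2 * (β * a)) = (t : ℝ) ^ (β * a) * (t : ℝ) ^ (β * a) := by
      rw [← Real.rpow_add ht']; ring_nf
    have hne : (t : ℝ) ^ (β * a) ≠ 0 := (Real.rpow_pos_of_pos ht' _).ne'
    rw [hvar t ht, Real.rpow_neg ht'.le, Real.rpow_neg ht'.le, h2]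
    field_simp
  have hd : β * a - β * max (a - 1) 0 = β * min a 1 := by
    rw [← mul_sub]
    congr 1
    rcases le_total a 1 with h | h
    · rw [max_eq_right (by linarith), min_eq_left h, sub_zero]
    · rw [max_eq_left (by linarith), min_eq_right h]; ring
  refine ⟨fun t => memLp_fnpp hN hD hND ha t, β * a - β * max (a - 1) 0, ?_, ?_, fun s hs => ?_⟩
  · rw [hd]
    exact mul_pos hβ (lt_min ha one_pos)
  · rw [hd]
    exact (mul_le_of_le_one_right hβ.le (min_le_right _ _)).trans_lt hβ1
  have hs' : (0 : ℝ) < s := hs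
  obtain ⟨L, hL0, hL1, hL⟩ := hD.exists_tendsto_covariance_inverse ha hβ haβ hs
  set A := ∫ ω, (measurableInverse D s ω : ℝ) ^ a ∂P with hAdef
  have hA : 0 < A := by
    rw [hAdef, hD.integral_inverse_rpow hs]
    positivity
  -- The Poisson term `κ * A` survives the normalisation only for `a ≤ 1`, where it ensures a
  -- positive limit. For `a > 1` it vanishes and positivity must come from `L`.
  have hcov : Tendsto (fun t : ℝ≥0 => (t : ℝ) ^ (-(β * max (a - 1) 0)) * (κ * A)
      + κ ^ 2 * ((t : ℝ) ^ (-(β * max (a - 1) 0)) *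
        covariance (fun ω => (measurableInverse D s ω : ℝ) ^ a)
          (fun ω => (measurableInverse D t ω : ℝ) ^ a) P)) atTop
      (𝓝 ((if 1 < a then 0 else κ * A) + κ ^ 2 * L)) := by
    refine Tendsto.add ?_ (hL.const_mul _)
    split_ifs with h
    · rw [max_eq_left (by linarith)]
      have := ((tendsto_rpow_neg_atTop (mul_pos hβ (sub_pos.2 h))).comp hcoe).mul_const (κ * A)
      simpa [Function.comp_def] using this
    · rw [max_eq_right (by linarith)]
      simp
  refine tendsto_correlation_div_rpow (C := (if 1 < a then 0 else κ * A) + κ ^ 2 * L) ?_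
    (by positivity) ?_ (hcov.congr' ?_) hvarlim
  · split_ifs with h
    · have : 0 < L := hL1 h ▸ hD.integral_tailProd_pos h hβ1 hs
      positivity
    · positivity
  · rw [hvar s hs]
    positivity
  · filter_upwards [eventually_ge_atTop s] with t hst
    rw [covariance_fnpp hN hD hND ha hst]
    ring

/-- The time change is deterministic, so only Poisson fluctuations remain: the variance is of order
`t ^ a` instead of `t ^ (2a)`, and the decay exponent is halved. -/
lemma hasLongRangeDependence_fnpp_one (ha : 0 < a) (ha1 : a < 1) (hb : 0 < b)
    (hN : IsPoissonProcess N 1 P) (hD : IsStableSubordinator D 1 P)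
    (hND : IndepFun (fun ω t => N t ω) (fun ω t => D t ω) P) :
    HasLongRangeDependence (fnpp N (weibullRate a b) D) P := by
  set κ : ℝ := ((b : ℝ) ^ a)⁻¹ with hκdef
  have hκ : 0 < κ := inv_pos.2 (Real.rpow_pos_of_pos hb a)
  have hpow : ∀ t : ℝ≥0, (fun ω => (measurableInverse D t ω : ℝ) ^ a) =ᵐ[P]
      fun _ => (t : ℝ) ^ a := fun t => by
    filter_upwards [hD.ae_inverse_eq_self t] with ω hω
    rw [hω]
  have hint : ∀ t : ℝ≥0, ∫ ω, (measurableInverse D t ω : ℝ) ^ a ∂P = (t : ℝ) ^ a := fun t => by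
    rw [integral_congr_ae (hpow t)]
    simp
  have hcov : ∀ s t : ℝ≥0, s ≤ t → covariance (fnpp N (weibullRate a b) D s)
      (fnpp N (weibullRate a b) D t) P = κ * (s : ℝ) ^ a := fun s t hst => by
    have h0 : covariance (fun ω => (measurableInverse D s ω : ℝ) ^ a)
        (fun ω => (measurableInverse D t ω : ℝ) ^ a) P = 0 := by
      refine integral_eq_zero_of_ae ?_
      filter_upwards [hpow s] with ω hω
      simp [hω, hint]
    rw [covariance_fnpp hN hD hND ha hst, hint, h0, mul_zero, add_zero]
  have hvar : ∀ t : ℝ≥0, variance (fnpp N (weibullRate a b) D t) P = κ * (t : ℝ) ^ a := fun t => by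
    rw [← covariance_self (aemeasurable_fnpp hN hD t), hcov t t le_rfl]
  -- The exponent has the form `p - q`, with `p = a / 2` for the standard deviation and `q = 0` for
  -- the covariance.
  refine ⟨fun t => memLp_fnpp hN hD hND ha t, a / 2 - 0, by linarith, by linarith, fun s hs => ?_⟩
  have hs' : (0 : ℝ) < s := hs
  refine tendsto_correlation_div_rpow (C := κ * (s : ℝ) ^ a) (V := κ) (by positivity) hκ ?_ ?_ ?_
  · rw [hvar]
    positivity
  · refine tendsto_const_nhds.congr' ?_
    filter_upwards [eventually_ge_atTop s] with t hst
    rw [hcov s t hst, neg_zero, Real.rpow_zero, one_mul]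
  · refine tendsto_const_nhds.congr' ?_
    filter_upwards [eventually_gt_atTop 0] with t ht
    have ht' : (0 : ℝ) < t := ht
    have hne : (t : ℝ) ^ a ≠ 0 := (Real.rpow_pos_of_pos ht' _).ne'
    rw [hvar, mul_div_cancel₀ a two_ne_zero, Real.rpow_neg ht'.le]
    field_simp

end Main

theorem mainTheorem6 {Ω : Type*} [MeasurableSpace Ω] (P : Measure Ω) [IsProbabilityMeasure P]
    (a β : ℝ) (b : ℝ≥0) (ha : 0 < a) (hb : 0 < b) (hβ : 0 < β) (hβ1 : β ≤ 1)
    (haβ : a * β < 1)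
    (N : ℝ≥0 → Ω → ℕ) (D : ℝ≥0 → Ω → ℝ)
    (hN : IsPoissonProcess N 1 P) (hD : IsStableSubordinator D β P)
    (hND : IndepFun (fun ω t => N t ω) (fun ω t => D t ω) P) :
    HasLongRangeDependence (fnpp N (weibullRate a b) D) P := by
  rcases hβ1.eq_or_lt with rfl | hlt
  · exact hasLongRangeDependence_fnpp_one ha (by linarith) hb hN hD hND
  · exact hasLongRangeDependence_fnpp_of_lt_one ha hb hβ hlt haβ hN hD hND
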